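/- **Setting.** Let $\mathcal X$ be a set of databases with an arbitrary neighbouring relation $\sim$, let $\mathcal Y$ be a measurable space, and let $\mathrm{Alg}$ be a randomized algorithm that maps each $x\in\mathcal X$ to a random sequence $\mathrm{Alg}(x)=(\mathrm{Alg}_n(x))_{n\ge 1}$ in $\mathcal Y$; write $\mathrm{Alg}_{1:n}(x)$ for its first $n$ terms. For random elements $A,A'$ of a measurable space whose laws have densities $p,p'$ with respect to a common dominating measure, the *privacy loss* between $A$ and $A'$ is the random variable $\log\big(p(A)/p'(A)\big)\in(-\infty,\infty]$ (equal to $+\infty$ where $p'(A)=0$; it is determined almost surely). Fix $\Delta>0$, $\epsilon_{\max}>0$, a threshold $\tau\in\mathbb R$, and a utility $u:\mathcal Y\times\mathcal X\to\mathbb R$, measurable in its first argument, with $|u(\beta,x)-u(\beta,x')|\le\Delta$ for all $\beta\in\mathcal Y$ and $x\sim x'$. Let $(\mathcal E_n)_{n\ge 1}$ be privacy functions, i.e. measurable functions $\mathcal E_n:\mathcal Y^{n-1}\to(0,\epsilon_{\max}]$ with $\mathcal E_n(\beta_{1:n-1})\le\mathcal E_{n+1}(\beta_{1:n})$ for all $n\ge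 1$ and $\beta_{1:n}\in\mathcal Y^n$. Write $\mathrm{Lap}(b)$ for the law on $\mathbb R$ with density $\frac1{2b}e^{-|z|/b}$. Put $\eta:=2\Delta/\epsilon_{\max}$. Let $(P_t)_{t\ge\eta}$ be an inhomogeneous Poisson process with $P_\eta=0$ and intensity $2/t$, let $\mathcal T_0:=\eta$ and let $\mathcal T_n:=\inf\{t\ge\eta:P_t\ge n\}$ for $n\ge1$. Define the Laplace process $Z_t:=\sum_{n=0}^{P_t}\mathcal T_n\Lambda_n$, $t\ge\eta$, where $\Lambda_0,\Lambda_1,\dots$ are i.i.d. $\mathrm{Lap}(1)$ variables independent of $(P_t)$ (so, given $(P_t)$, the summands are independent with laws $\mathrm{Lap}(\mathcal T_n)$). **The mechanism.** $\mathrm{ReducedAboveThreshold}(x)$ proceeds in rounds $n=1,2,\dots$. In round $n$ it sets $\epsilon_n:=\mathcal E_n(\mathrm{Alg}_{1:n-1}(x))$, $T_n:=2\Delta/\epsilon_n$ and $\zeta_n:=Z_{T_n}$, and lets $\xi_n:=\frac{4\Delta}{\epsilon_n}\xi_n^\circ$, where $\xi^\circ_1,\xi^\circ_2,\dots$ are i.i.d.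 $\mathrm{Lap}(1)$. If $u(\mathrm{Alg}_n(x),x)+\xi_n\ge\tau+\zeta_n$, it prints the bit $\alpha_n(x)=1$ and halts; otherwise it prints $\alpha_n(x)=0$ and continues. For each database $x$, the sequence $\mathrm{Alg}(x)$, the Poisson process $(P_t)$, the sequence $(\Lambda_n)$ and the sequence $(\xi^\circ_n)$ are mutually independent. Let $N(x)\in\{1,2,\dots\}\cup\{\infty\}$ be the first round in which $1$ is printed. The output of $\mathrm{ReducedAboveThreshold}(x)$ is the whole transcript of iterates and bits, $(\mathrm{Alg}_n(x),\alpha_n(x))_{1\le n\le N(x)}$ (an infinite sequence if $N(x)=\infty$). **Theorem.** The output of $\mathrm{ReducedAboveThreshold}(y)$ is a (a.e.) measurable random element for every $y\in\mathcal X$. Let $x\sim x'$ be neighbours, let $\mathcal L^{\mathrm{RAT}}(x,x')$ be the privacy loss between $\mathrm{ReducedAboveThreshold}(x)$ and $\mathrm{ReducedAboveThreshold}(x')$, and for $n\ge1$ let $\mathcal L^{\mathrm{Alg}}_{1:n}(x,x')$ be the privacy loss between $\mathrm{Alg}_{1:n}(x)$ and $\mathrm{Alg}_{1:n}(x')$.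 Then, almost surely on the event $\{N(x)<\infty\}$, $$\mathcal L^{\mathrm{RAT}}(x,x')\;\le\;\mathcal L^{\mathrm{Alg}}_{1:N(x)}(x,x')+\mathcal E_{N(x)}\big(\mathrm{Alg}_{1:N(x)-1}(x)\big).$$ -/

import Mathlib

open MeasureTheory ProbabilityTheory Set
open scoped ENNReal NNReal

noncomputable section

/-- Privacy loss at the point `y` between algorithms with output laws `P` and `Q`: the logarithm of
the ratio of their densities. Densities are taken with respect to the dominating measure `P + Q`
(the ratio does not depend on the dominating measure, up to a `P`-null set). The value is `⊤`
where the density of `Q` vanishes and that of `P` does not. -/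
def privacyLoss {S : Type*} [MeasurableSpace S] (P Q : Measure S) (y : S) : EReal :=
  ENNReal.log (P.rnDeriv (P + Q) y / Q.rnDeriv (P + Q) y)

/-- The (centred) Laplace distribution with scale `b > 0`. -/
def laplaceMeasure (b : ℝ) : Measure ℝ :=
  volume.withDensity fun z => ENNReal.ofReal (Real.exp (-|z| / b) / (2 * b))

/-- `b` times a standard Laplace variable is a Laplace variable with scale `b`. -/
theorem laplaceMeasure_one_map_mul {b : ℝ} (hb : 0 < b) :
    (laplaceMeasure 1).map (fun z => b * z) = laplaceMeasure b := by
  have hm : ∀ c : ℝ, Measurable fun z : ℝ => ENNReal.ofReal (Real.exp (-|z| / c) / (2 * c)) := by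
    intro c
    fun_prop
  ext s hs
  rw [Measure.map_apply (by fun_prop) hs, laplaceMeasure, laplaceMeasure,
    withDensity_apply _ (hs.preimage (by fun_prop)), withDensity_apply _ hs,
    ← lintegral_indicator (hs.preimage (by fun_prop)), ← lintegral_indicator hs]
  have hv : (volume : Measure ℝ) = ENNReal.ofReal |b| • Measure.map (b * ·) volume :=
    (Real.smul_map_volume_mul_left hb.ne').symm
  conv_rhs => rw [hv]
  rw [lintegral_smul_measure, lintegral_map ((hm b).indicator hs) (by fun_prop), smul_eq_mul,
    ← lintegral_const_mul' _ _ ENNReal.ofReal_ne_top]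
  refine lintegral_congr fun z => ?_
  by_cases hz : b * z ∈ s
  · rw [indicator_of_mem (by exact hz), indicator_of_mem hz, ← ENNReal.ofReal_mul (by positivity),
      abs_mul, abs_of_pos hb]
    congr 1
    field_simp
  · rw [indicator_of_notMem (by exact hz), indicator_of_notMem hz, mul_zero]

/-- `(N_t)_{t ≥ η}` is an inhomogeneous Poisson process on `[η, ∞)` with intensity function `lam`:
a counting process started at `0` at time `η`, with nondecreasing right-continuous paths and
independent Poisson increments. (Values at times below `η` play no role.) -/
structure IsPoissonProcess {Ω : Type*} [MeasurableSpace Ω] (η : ℝ) (lam : ℝ → ℝ)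
    (N : ℝ → Ω → ℕ) (μ : Measure Ω) : Prop where
  measurable : ∀ t, η ≤ t → Measurable (N t)
  init : ∀ ω, N η ω = 0
  mono : ∀ ω, MonotoneOn (fun t => N t ω) (Ici η)
  right_cont : ∀ ω t, η ≤ t → ContinuousWithinAt (fun s => N s ω) (Ici t) t
  indep : HasIndepIncrements (fun t : Ici η => N (t : ℝ)) μ
  law : ∀ s t, η ≤ s → s ≤ t →
    HasLaw (fun ω => N t ω - N s ω) (poissonMeasure (∫ r in s..t, lam r).toNNReal) μ

/-- The time of the `n`-th jump of a counting path `p` on `[η, ∞)`; the `0`-th one is `η`. -/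
def jumpTime (η : ℝ) (p : ℝ → ℕ) : ℕ → ℝ
  | 0 => η
  | n + 1 => sInf {t : ℝ | η ≤ t ∧ n + 1 ≤ p t}

/-- The path of the Laplace process: `Z_t = ∑_{n = 0}^{P_t} Lap(𝒯_n)`, where `𝒯_n` is the `n`-th jump
time and the Laplace variable with (random) scale `𝒯_n` is `𝒯_n * l n`, for independent standard
Laplace variables `l n`. -/
def laplacePath (η : ℝ) (p : ℝ → ℕ) (l : ℕ → ℝ) (t : ℝ) : ℝ :=
  ∑ n ∈ Finset.range (p t + 1), jumpTime η p n * l n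

/-- A sequence of independent standard Laplace random variables. -/
structure IsStdLaplaceSeq {Ω : Type*} [MeasurableSpace Ω] (l : ℕ → Ω → ℝ) (μ : Measure Ω) :
    Prop where
  measurable : ∀ n, Measurable (l n)
  law : ∀ n, HasLaw (l n) (laplaceMeasure 1) μ
  indep : iIndepFun l μ

/-- The internal randomness of the mechanism: a Poisson process `N` on `[η, ∞)` with intensity `2 / t`
and a sequence `l` of standard Laplace variables, driving the Laplace process, and a sequence `ξ` of
standard Laplace variables for the query noise, the three being mutually independent. -/
structure IsThresholdNoise {Ω : Type*} [MeasurableSpace Ω] (η : ℝ) (N : ℝ → Ω → ℕ)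
    (l ξ : ℕ → Ω → ℝ) (μ : Measure Ω) : Prop where
  poisson : IsPoissonProcess η (fun t => 2 / t) N μ
  marks : IsStdLaplaceSeq l μ
  query : IsStdLaplaceSeq ξ μ
  indep_marks : IndepFun (fun ω (t : Ici η) => N t ω) (fun ω n => l n ω) μ
  indep_query : IndepFun (fun ω => ((fun t : Ici η => N t ω), fun n => l n ω))
    (fun ω n => ξ n ω) μ

/-- The first `n` terms `a_{1:n}` of a sequence (the `k`-th term is `a (k - 1)`). -/
def firstTerms {S : Type*} (a : ℕ → S) (n : ℕ) : Fin n → S := fun i => a i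

/-- A sequence of privacy functions: `E k`, a function of the first `k` iterates, is the privacy level
of round `k + 1`. Levels are positive, at most `εmax`, and nondecreasing along the rounds
(the corresponding times `2Δ / E k` are nonincreasing). -/
structure IsPrivacyFunctions {Y : Type*} [MeasurableSpace Y] (εmax : ℝ)
    (E : (k : ℕ) → (Fin k → Y) → ℝ) : Prop where
  measurable : ∀ k, Measurable (E k)
  pos : ∀ k β, 0 < E k β
  le_max : ∀ k β, E k β ≤ εmax
  mono : ∀ (k : ℕ) (β : Fin (k + 1) → Y), E k (fun i => β i.castSucc) ≤ E (k + 1) β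

/-- The comparison bit of round `k + 1`: whether `u(a_{k+1}) + ξ_{k+1} ≥ τ + Z_T`, where
`ε = E k a_{1:k}` is the privacy level, `T = 2Δ / ε`, and the query noise `ξ_{k+1} ~ Lap(4Δ / ε)`
is `4Δ / ε` times a standard Laplace variable `ξ k`. Here `v` is the utility on the database at
hand, `a` the sequence of iterates and `z` the path of the threshold noise. -/
def ratBit {Y : Type*} (Δ τ : ℝ) (v : Y → ℝ) (E : (k : ℕ) → (Fin k → Y) → ℝ)
    (a : ℕ → Y) (z : ℝ → ℝ) (ξ : ℕ → ℝ) (k : ℕ) : Bool :=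
  let ε := E k (firstTerms a k)
  decide (τ + z (2 * Δ / ε) ≤ v (a k) + 4 * Δ / ε * ξ k)

/-- The first round (counted from `1`) with bit `1`, or `⊤` if there is none;
`b k` is the bit of round `k + 1`. -/
def haltingRound (b : ℕ → Bool) : ℕ∞ :=
  sInf {m : ℕ∞ | ∃ k : ℕ, m = (k : ℕ∞) + 1 ∧ b k = true}

/-- Transcripts of pairs (iterate, printed bit): either of a finite number of rounds, or, when the
mechanism never halts, of all rounds. -/
abbrev Transcript (Y : Type*) : Type _ := (Σ n : ℕ, Fin n → Y × Bool) ⊕ (ℕ → Y × Bool)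

/-- The transcript of a run which sees iterates `a`, computes bits `b`, and stops
after printing the first `1`. -/
def haltedTranscript {Y : Type*} (a : ℕ → Y) (b : ℕ → Bool) : Transcript Y :=
  if haltingRound b = ⊤ then Sum.inr fun k => (a k, b k)
  else Sum.inl ⟨(haltingRound b).toNat, firstTerms (fun k => (a k, b k)) (haltingRound b).toNat⟩

/-- The sequence of comparison bits of `ReducedAboveThreshold`, with threshold noise given by the
Laplace process on `[2Δ / εmax, ∞)` driven by the counting path `p` and the marks `l`. -/
def reducedAboveThresholdBits {Y : Type*} (Δ εmax τ : ℝ) (v : Y → ℝ)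
    (E : (k : ℕ) → (Fin k → Y) → ℝ) (a : ℕ → Y) (p : ℝ → ℕ) (l ξ : ℕ → ℝ) : ℕ → Bool :=
  ratBit Δ τ v E a (laplacePath (2 * Δ / εmax) p l) ξ

/-- The output of `ReducedAboveThreshold`: the iterates seen and the bits printed until it halts. -/
def reducedAboveThreshold {Y : Type*} (Δ εmax τ : ℝ) (v : Y → ℝ)
    (E : (k : ℕ) → (Fin k → Y) → ℝ) (a : ℕ → Y) (p : ℝ → ℕ) (l ξ : ℕ → ℝ) : Transcript Y :=
  haltedTranscript a (reducedAboveThresholdBits Δ εmax τ v E a p l ξ)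

end

/-! Fix the iterates. Since the levels `E k` are nondecreasing, the times `T_k = 2Δ / ε_k` decrease,
so the process is read backwards: if the run stops in round `m`, every earlier threshold is `Z_{T_k}
= Z_{T_m} + (increment after T_m)`. The increments are independent of `Z_{T_m}`, and `Z_{T_m}` has
law Lap(`T_m`). With the increments and the earlier query noises frozen, raise `Z_{T_m}` by `Δ` and
the last query noise by `2Δ`. All thresholds rise by `Δ`, which absorbs the change of utility in the
rounds answering 0. In the last round the extra `2Δ` pays for the higher threshold and for a
possible loss of utility. The price is `Δ / T_m + 2Δ / (4Δ / ε_m) = ε_m / 2 + ε_m / 2`, whatever the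
number of rounds (`IsThresholdNoise.measure_haltingEvent_le`).

Two facts about the process are needed. Independence of `Z_t` from the future
(`laplacePath_indepFun_future`) follows from independent Poisson increments and independent marks;
the future marks start at a random index, which `indepFun_of_random_index` handles. The marginal law
(`map_laplacePath`) comes from the characteristic function `f(t)` of `Z_t`: with jump rate `2/t` and
jumps of law Lap(`t`), `f' = (2/t) (1/(1 + t²θ²) - 1) f`, so `f(t) (1 + t²θ²)` is constant.

Finally, the iterates are independent of the noise, so on runs halting in a given round the law of
the transcript is the law of the iterates weighted by the conditional halting probability
(`restrict_map_haltedTranscript`). A bound `p ≤ exp ε * p'` on the weights adds at most `ε` to the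
privacy loss (`privacyLoss_le_privacyLoss_add`). -/

noncomputable section

/-! ### Independence -/

/-- Regrouping two independent pairs `(A, B)` and `(C, D)` with independent entries. -/
theorem indepFun_prodMk_prodMk_of_indepFun {Ω α β γ δ : Type*} [MeasurableSpace Ω]
    [MeasurableSpace α] [MeasurableSpace β] [MeasurableSpace γ] [MeasurableSpace δ]
    {μ : Measure Ω} [IsProbabilityMeasure μ] {A : Ω → α} {B : Ω → β} {C : Ω → γ} {D : Ω → δ}
    (hA : Measurable A) (hB : Measurable B) (hC : Measurable C) (hD : Measurable D)
    (hAB : IndepFun A B μ) (hCD : IndepFun C D μ)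
    (h : IndepFun (fun ω => (A ω, B ω)) (fun ω => (C ω, D ω)) μ) :
    IndepFun (fun ω => (A ω, C ω)) (fun ω => (B ω, D ω)) μ := by
  have hAC : IndepFun A C μ := h.comp measurable_fst measurable_fst
  have hBD : IndepFun B D μ := h.comp measurable_snd measurable_snd
  have pA := Measure.isProbabilityMeasure_map (μ := μ) hA.aemeasurable
  have pB := Measure.isProbabilityMeasure_map (μ := μ) hB.aemeasurable
  have pC := Measure.isProbabilityMeasure_map (μ := μ) hC.aemeasurable
  have pD := Measure.isProbabilityMeasure_map (μ := μ) hD.aemeasurable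
  rw [indepFun_iff_map_prod_eq_prod_map_map (by fun_prop) (by fun_prop)] at *
  rw [hAC, hBD]
  rw [hAB, hCD] at h
  -- The product of the four laws is carried to its regrouping by reassociating, exchanging the
  -- factors of `B` and `C`, and reassociating back.
  have h1 : MeasurePreserving (fun p : (α × β) × (γ × δ) => (p.1.1, (p.1.2, p.2)))
      (((μ.map A).prod (μ.map B)).prod ((μ.map C).prod (μ.map D)))
      ((μ.map A).prod ((μ.map B).prod ((μ.map C).prod (μ.map D)))) :=
    measurePreserving_prodAssoc _ _ _
  have h2 : MeasurePreserving (fun p : β × (γ × δ) => (p.2.1, (p.1, p.2.2)))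
      ((μ.map B).prod ((μ.map C).prod (μ.map D)))
      ((μ.map C).prod ((μ.map B).prod (μ.map D))) :=
    ((measurePreserving_prodAssoc _ _ _).comp
      ((Measure.measurePreserving_swap (μ := μ.map B) (ν := μ.map C)).prod
        (MeasurePreserving.id (μ.map D)))).comp
      ((measurePreserving_prodAssoc (μ.map B) (μ.map C) (μ.map D)).symm
        (MeasurableEquiv.prodAssoc))
  have h3 := (((measurePreserving_prodAssoc (μ.map A) (μ.map C)
    ((μ.map B).prod (μ.map D))).symm MeasurableEquiv.prodAssoc).comp
      ((MeasurePreserving.id (μ.map A)).prod h2)).comp h1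
  rw [← h3.map_eq, ← h, Measure.map_map h3.measurable (by fun_prop)]
  rfl

/-- If `Y = Y_K` for a random index `K`, where `Y_m` has the same law `ν` for all `m` and is
independent of `(K, X_m)`, then `Y` has law `ν` and is independent of `X = X_K`. -/
theorem indepFun_of_random_index {Ω α β : Type*} [MeasurableSpace Ω]
    [MeasurableSpace α] [MeasurableSpace β] {μ : Measure Ω} [IsProbabilityMeasure μ]
    {K : Ω → ℕ} {X : Ω → α} {Y : Ω → β} {X' : ℕ → Ω → α} {Y' : ℕ → Ω → β} {ν : Measure β}
    (hK : Measurable K) (hX' : ∀ m, Measurable (X' m)) (hY' : ∀ m, Measurable (Y' m))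
    (hX : ∀ ω, X ω = X' (K ω) ω) (hY : ∀ ω, Y ω = Y' (K ω) ω)
    (h : ∀ m, IndepFun (fun ω => (K ω, X' m ω)) (Y' m) μ) (hν : ∀ m, μ.map (Y' m) = ν) :
    Measurable X ∧ Measurable Y ∧ IndepFun X Y μ ∧ μ.map Y = ν := by
  have hXm : Measurable X := by
    have : X = (fun p : ℕ × Ω => X' p.1 p.2) ∘ (fun ω => (K ω, ω)) := funext hX
    rw [this]
    exact (measurable_from_prod_countable_right hX').comp (hK.prodMk measurable_id)
  have hYm : Measurable Y := by
    have : Y = (fun p : ℕ × Ω => Y' p.1 p.2) ∘ (fun ω => (K ω, ω)) := funext hY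
    rw [this]
    exact (measurable_from_prod_countable_right hY').comp (hK.prodMk measurable_id)
  have split : ∀ S : Set Ω, MeasurableSet S → μ S = ∑' m, μ (S ∩ K ⁻¹' {m}) := by
    intro S hS
    rw [← measure_iUnion]
    · congr 1
      ext ω
      simp
    · intro i j hij
      refine disjoint_left.2 fun ω h1 h2 => hij ?_
      exact h1.2.symm.trans h2.2
    · exact fun m => hS.inter (hK (measurableSet_singleton m))
  -- On `{K = m}` the pair is `(X' m, Y' m)`. Independence of `Y' m` from `(K, X' m)` extracts the
  -- factor `ν t`, the same for every `m`, and the remaining terms sum to the probability of `X ∈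
  -- s`.
  have key : ∀ s t, MeasurableSet s → MeasurableSet t →
      μ (X ⁻¹' s ∩ Y ⁻¹' t) = μ (X ⁻¹' s) * ν t := by
    intro s t hs ht
    rw [split _ ((hXm hs).inter (hYm ht)), split _ (hXm hs), ← ENNReal.tsum_mul_right]
    refine tsum_congr fun m => ?_
    have e1 : X ⁻¹' s ∩ Y ⁻¹' t ∩ K ⁻¹' {m}
        = (fun ω => (K ω, X' m ω)) ⁻¹' ({m} ×ˢ s) ∩ Y' m ⁻¹' t := by
      ext ω
      simp only [mem_inter_iff, mem_preimage, mem_singleton_iff, mem_prod, hX, hY]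
      constructor
      · rintro ⟨⟨h1, h2⟩, rfl⟩
        exact ⟨⟨rfl, h1⟩, h2⟩
      · rintro ⟨⟨rfl, h1⟩, h2⟩
        exact ⟨⟨h1, h2⟩, rfl⟩
    have e2 : X ⁻¹' s ∩ K ⁻¹' {m} = (fun ω => (K ω, X' m ω)) ⁻¹' ({m} ×ˢ s) := by
      ext ω
      simp only [mem_inter_iff, mem_preimage, mem_singleton_iff, mem_prod, hX]
      constructor
      · rintro ⟨h1, rfl⟩
        exact ⟨rfl, h1⟩
      · rintro ⟨rfl, h1⟩
        exact ⟨h1, rfl⟩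
    rw [e1, e2, (h m).measure_inter_preimage_eq_mul _ _
      ((measurableSet_singleton m).prod hs) ht, ← hν m, Measure.map_apply (hY' m) ht]
  have hlaw : μ.map Y = ν := by
    ext t ht
    have := key univ t MeasurableSet.univ ht
    rw [Measure.map_apply hYm ht]
    simpa using this
  refine ⟨hXm, hYm, ?_, hlaw⟩
  rw [indepFun_iff_measure_inter_preimage_eq_mul]
  intro s t hs ht
  rw [key s t hs ht, ← hlaw, Measure.map_apply hYm ht]

/-! ### Privacy loss -/

/-- Passes from a cross-multiplied inequality of densities, which makes sense even where some of
them vanish, to one of losses. Where `g = 0`, the condition `f ≠ 0` makes the right side `⊤`. -/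
theorem ENNReal.log_div_le_log_div_add {r r' f g : ℝ≥0∞} {ε : ℝ} (hf : f ≠ 0) (hg : g ≠ ∞) (h : r * g ≤ r' * (ENNReal.ofReal (Real.exp ε) * f)) :
    ENNReal.log (r / r') ≤ ENNReal.log (f / g) + (ε : EReal) := by
  have he : (ε : EReal) = ENNReal.log (ENNReal.ofReal (Real.exp ε)) := by
    rw [ENNReal.log_ofReal_of_pos (Real.exp_pos _), Real.log_exp]
  have he0 : ENNReal.ofReal (Real.exp ε) ≠ 0 := by
    simpa using Real.exp_pos ε
  rw [he, ← ENNReal.log_mul_add]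
  refine ENNReal.log_monotone ?_
  rcases eq_or_ne g 0 with rfl | hg0
  · rw [ENNReal.div_zero hf, ENNReal.top_mul he0]
    exact le_top
  refine ENNReal.div_le_of_le_mul ?_
  calc r ≤ r' * (ENNReal.ofReal (Real.exp ε) * f) / g :=
        (ENNReal.le_div_iff_mul_le (Or.inl hg0) (Or.inl hg)).2 h
    _ = f / g * ENNReal.ofReal (Real.exp ε) * r' := by
        simp only [div_eq_mul_inv]
        ring

/-- Both sides are the integral of `h` over `A ∩ s` against `R`, written once with the density of
`R` and once, through `emb`, with that of `P`. It brings two laws on `S` down to the common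
dominating measure on `S'`. -/
theorem setLIntegral_indicator_rnDeriv_mul {S S' : Type*} [MeasurableSpace S] [MeasurableSpace S']
    {R ρ : Measure S} {P M : Measure S'} [SigmaFinite R] [SigmaFinite ρ] [SigmaFinite P]
    [SigmaFinite M] (hRρ : R ≪ ρ) (hPM : P ≪ M) {s : Set S} (hs : MeasurableSet s) {emb : S' → S}
    (hemb : Measurable emb) {p : S' → ℝ≥0∞} (hp : Measurable p)
    (hR : R.restrict s = (P.withDensity p).map emb) {h : S → ℝ≥0∞} (hh : Measurable h)
    {A : Set S} (hA : MeasurableSet A) :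
    ∫⁻ y in A, s.indicator (fun y => R.rnDeriv ρ y * h y) y ∂ρ
      = ∫⁻ β in emb ⁻¹' A, P.rnDeriv M β * (p β * h (emb β)) ∂M := by
  have h1 := Measure.withDensity_rnDeriv_eq _ _ hRρ
  have h2 := Measure.withDensity_rnDeriv_eq _ _ hPM
  calc ∫⁻ y in A, s.indicator (fun y => R.rnDeriv ρ y * h y) y ∂ρ
      = ∫⁻ y, R.rnDeriv ρ y * (A ∩ s).indicator h y ∂ρ := by
        rw [← lintegral_indicator hA]
        refine lintegral_congr fun y => ?_
        by_cases hyA : y ∈ A <;> by_cases hys : y ∈ s <;> simp [hyA, hys]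
    _ = ∫⁻ y, (A ∩ s).indicator h y ∂(R) := by
        conv_rhs => rw [← h1]
        rw [lintegral_withDensity_eq_lintegral_mul _ (Measure.measurable_rnDeriv _ _)
          (hh.indicator (hA.inter hs))]
        rfl
    _ = ∫⁻ y, A.indicator h y ∂(R.restrict s) := by
        rw [← lintegral_indicator hs]
        refine lintegral_congr fun y => ?_
        by_cases hyA : y ∈ A <;> by_cases hys : y ∈ s <;> simp [hyA, hys]
    _ = ∫⁻ β, p β * A.indicator h (emb β) ∂P := by
        rw [hR, lintegral_map (hh.indicator hA) hemb]
        exact lintegral_withDensity_eq_lintegral_mul P hp ((hh.indicator hA).comp hemb)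
    _ = ∫⁻ β, P.rnDeriv M β * (p β * A.indicator h (emb β)) ∂M := by
        conv_lhs => rw [← h2]
        exact lintegral_withDensity_eq_lintegral_mul M (Measure.measurable_rnDeriv _ _)
          (hp.mul ((hh.indicator hA).comp hemb))
    _ = _ := by
        rw [← lintegral_indicator (hemb hA)]
        refine lintegral_congr fun β => ?_
        by_cases hβ : emb β ∈ A <;> simp [hβ]

/-- Suppose that on a set `s` the laws `R` and `R'` are images under a map `emb` of `P` and `Q`,
reweighted by `p` and `p'` with `p ≤ exp ε * p'`. Then on `s` the privacy loss between `R` and `R'`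
exceeds the one between `P` and `Q` by at most `ε`. -/
theorem privacyLoss_le_privacyLoss_add {S S' : Type*} [MeasurableSpace S] [MeasurableSpace S']
    {R R' : Measure S} {P Q : Measure S'} [IsFiniteMeasure R] [IsFiniteMeasure R']
    [IsFiniteMeasure P] [IsFiniteMeasure Q] {s : Set S} (hs : MeasurableSet s) {emb : S' → S}
    (hemb : Measurable emb) {π : S → S'} (hπ : Measurable π) (hπe : ∀ β, π (emb β) = β)
    {p p' : S' → ℝ≥0∞} (hp : Measurable p) (hp' : Measurable p')
    (hR : R.restrict s = (P.withDensity p).map emb)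
    (hR' : R'.restrict s = (Q.withDensity p').map emb) {ε : S' → ℝ} (hε : Measurable ε)
    (hpp' : ∀ β, p β ≤ ENNReal.ofReal (Real.exp (ε β)) * p' β) :
    ∀ᵐ y ∂(R), y ∈ s → privacyLoss R R' y ≤ privacyLoss P Q (π y) + (ε (π y) : EReal) := by
  set ρ := R + R' with hρ
  set M := P + Q with hM
  have hRρ : R ≪ ρ := Measure.AbsolutelyContinuous.rfl.add_right _
  have hR'ρ : R' ≪ ρ := by
    rw [hρ, add_comm]
    exact Measure.AbsolutelyContinuous.rfl.add_right _
  have hPM : P ≪ M := Measure.AbsolutelyContinuous.rfl.add_right _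
  have hQM : Q ≪ M := by
    rw [hM, add_comm]
    exact Measure.AbsolutelyContinuous.rfl.add_right _
  have hf := Measure.measurable_rnDeriv P M
  have hg := Measure.measurable_rnDeriv Q M
  have hem : Measurable fun β => ENNReal.ofReal (Real.exp (ε β)) := by fun_prop
  have hgπ : Measurable fun y => Q.rnDeriv M (π y) := hg.comp hπ
  have hfπ : Measurable fun y => ENNReal.ofReal (Real.exp (ε (π y))) * P.rnDeriv M (π y) :=
    (hem.comp hπ).mul (hf.comp hπ)
  -- Each density on `S` is multiplied by the density of the opposite law on `S'`. Over any test set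
  -- `A`, both integrals then carry the same product of the densities of `P` and `Q`, and only the
  -- weights `p` and `exp ε * p'` differ.
  have hle : s.indicator (fun y => R.rnDeriv ρ y * Q.rnDeriv M (π y)) ≤ᵐ[ρ]
      s.indicator (fun y => R'.rnDeriv ρ y *
        (ENNReal.ofReal (Real.exp (ε (π y))) * P.rnDeriv M (π y))) := by
    refine ae_le_of_forall_setLIntegral_le_of_sigmaFinite
      (((Measure.measurable_rnDeriv _ _).mul hgπ).indicator hs) fun A hA _ => ?_
    rw [setLIntegral_indicator_rnDeriv_mul hRρ hPM hs hemb hp hR hgπ hA,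
      setLIntegral_indicator_rnDeriv_mul hR'ρ hQM hs hemb hp' hR' hfπ hA]
    refine lintegral_mono fun β => ?_
    simp only [hπe]
    calc P.rnDeriv M β * (p β * Q.rnDeriv M β)
        ≤ P.rnDeriv M β * (ENNReal.ofReal (Real.exp (ε β)) * p' β * Q.rnDeriv M β) := by
          gcongr
          exact hpp' β
      _ = _ := by ring
  -- On `s`, `R` is the image of a measure absolutely continuous with respect to `P`, so `P`-null
  -- exceptional sets may be ignored.
  have hfg : ∀ᵐ y ∂(R), y ∈ s → P.rnDeriv M (π y) ≠ 0 ∧ Q.rnDeriv M (π y) ≠ ∞ := by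
    rw [← ae_restrict_iff' hs, hR]
    have hm : MeasurableSet {y | P.rnDeriv M (π y) ≠ 0 ∧ Q.rnDeriv M (π y) ≠ ∞} :=
      (((hf.comp hπ) (measurableSet_singleton 0)).compl).inter
        (((hg.comp hπ) (measurableSet_singleton ∞)).compl)
    rw [ae_map_iff hemb.aemeasurable hm]
    refine (withDensity_absolutelyContinuous P p).ae_le ?_
    filter_upwards [Measure.rnDeriv_pos hPM, hPM.ae_le (Measure.rnDeriv_lt_top Q M)] with β h1 h2
    rw [hπe]
    exact ⟨h1.ne', h2.ne⟩
  filter_upwards [hRρ.ae_le hle, hfg] with y h1 h2 hys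
  rw [indicator_of_mem hys, indicator_of_mem hys] at h1
  exact ENNReal.log_div_le_log_div_add (h2 hys).1 (h2 hys).2 h1

/-! ### The Laplace distribution -/

/-- The half-lines contribute `1 / (2(1 + iθ))` and `1 / (2(1 - iθ))`. The case `θ = 0` gives the
total mass. -/
theorem integral_exp_mul_I_sub_abs (θ : ℝ) :
    Integrable (fun z : ℝ => Complex.exp (θ * z * Complex.I) * (Real.exp (-|z| / 1) / (2 * 1) : ℝ))
    ∧ ∫ z : ℝ, Complex.exp (θ * z * Complex.I) * (Real.exp (-|z| / 1) / (2 * 1) : ℝ)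
      = ((1 / (1 + θ ^ 2) : ℝ) : ℂ) := by
  have h1 : ∀ z ∈ Iic (0 : ℝ),
      Complex.exp (θ * z * Complex.I) * (Real.exp (-|z| / 1) / (2 * 1) : ℝ)
        = 2⁻¹ * Complex.exp ((1 + θ * Complex.I) * z) := by
    intro z hz
    rw [abs_of_nonpos hz]
    push_cast
    rw [show (1 + θ * Complex.I) * (z : ℂ) = θ * z * Complex.I + - -(z : ℂ) / 1 by ring,
      Complex.exp_add]
    ring
  have h2 : ∀ z ∈ Ioi (0 : ℝ),
      Complex.exp (θ * z * Complex.I) * (Real.exp (-|z| / 1) / (2 * 1) : ℝ)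
        = 2⁻¹ * Complex.exp ((-1 + θ * Complex.I) * z) := by
    intro z hz
    rw [abs_of_pos hz]
    push_cast
    rw [show (-1 + θ * Complex.I) * (z : ℂ) = θ * z * Complex.I + -(z : ℂ) / 1 by ring,
      Complex.exp_add]
    ring
  have hre1 : (0 : ℝ) < (1 + θ * Complex.I).re := by simp
  have hre2 : (-1 + θ * Complex.I).re < 0 := by simp
  have i1 : IntegrableOn (fun z : ℝ =>
      Complex.exp (θ * z * Complex.I) * (Real.exp (-|z| / 1) / (2 * 1) : ℝ)) (Iic 0) := by
    rw [integrableOn_congr_fun h1 measurableSet_Iic]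
    exact (integrableOn_exp_mul_complex_Iic hre1 0).const_mul _
  have i2 : IntegrableOn (fun z : ℝ =>
      Complex.exp (θ * z * Complex.I) * (Real.exp (-|z| / 1) / (2 * 1) : ℝ)) (Ioi 0) := by
    rw [integrableOn_congr_fun h2 measurableSet_Ioi]
    exact (integrableOn_exp_mul_complex_Ioi hre2 0).const_mul _
  refine ⟨?_, ?_⟩
  · rw [← integrableOn_univ, ← Iic_union_Ioi (a := (0 : ℝ))]
    exact i1.union i2
  · rw [← setIntegral_univ, ← Iic_union_Ioi (a := (0 : ℝ)),
      setIntegral_union (Iic_disjoint_Ioi le_rfl) measurableSet_Ioi i1 i2,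
      setIntegral_congr_fun measurableSet_Iic h1, setIntegral_congr_fun measurableSet_Ioi h2,
      integral_const_mul, integral_const_mul, integral_exp_mul_complex_Iic hre1,
      integral_exp_mul_complex_Ioi hre2]
    have n1 : (1 + θ * Complex.I : ℂ) ≠ 0 := fun h => by simp [h] at hre1
    have n2 : (-1 + θ * Complex.I : ℂ) ≠ 0 := fun h => by simp [h] at hre2
    have n3 : ((1 + θ ^ 2 : ℝ) : ℂ) ≠ 0 := by
      exact_mod_cast (by positivity : (1 + θ ^ 2 : ℝ) ≠ 0)
    push_cast at n3 ⊢
    simp only [mul_zero, Complex.exp_zero]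
    field_simp
    linear_combination (-2 * (θ : ℂ) ^ 2) * Complex.I_sq

theorem measurable_laplaceDensity (b : ℝ) :
    Measurable fun z : ℝ => ENNReal.ofReal (Real.exp (-|z| / b) / (2 * b)) := by
  fun_prop

instance isProbabilityMeasure_laplaceMeasure_one : IsProbabilityMeasure (laplaceMeasure 1) := by
  obtain ⟨hi, he⟩ := integral_exp_mul_I_sub_abs 0
  simp only [Complex.ofReal_zero, zero_mul, Complex.exp_zero, one_mul] at hi he
  have hi' : Integrable (fun z : ℝ => Real.exp (-|z| / 1) / (2 * 1)) :=
    by simpa only [Complex.ofReal_re, RCLike.re_to_complex] using hi.re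
  rw [integral_complex_ofReal] at he
  have he' : ∫ z : ℝ, Real.exp (-|z| / 1) / (2 * 1) = 1 := by
    refine Complex.ofReal_injective (he.trans ?_)
    simp
  constructor
  rw [laplaceMeasure, withDensity_apply _ MeasurableSet.univ, setLIntegral_univ,
    ← ofReal_integral_eq_lintegral_ofReal hi' (Filter.Eventually.of_forall fun z => by positivity),
    he', ENNReal.ofReal_one]

theorem isProbabilityMeasure_laplaceMeasure {b : ℝ} (hb : 0 < b) :
    IsProbabilityMeasure (laplaceMeasure b) := by
  rw [← laplaceMeasure_one_map_mul hb]
  exact Measure.isProbabilityMeasure_map (by fun_prop)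

theorem charFun_laplaceMeasure {b : ℝ} (hb : 0 < b) (θ : ℝ) :
    charFun (laplaceMeasure b) θ = ((1 / (1 + (b * θ) ^ 2) : ℝ) : ℂ) := by
  rw [← laplaceMeasure_one_map_mul hb, charFun_map_mul, charFun_apply_real, laplaceMeasure,
    integral_withDensity_eq_integral_toReal_smul (measurable_laplaceDensity 1)
      (Filter.Eventually.of_forall fun _ => ENNReal.ofReal_lt_top),
    ← (integral_exp_mul_I_sub_abs (b * θ)).2]
  refine integral_congr_ae (Filter.Eventually.of_forall fun z => ?_)
  simp only
  rw [ENNReal.toReal_ofReal (by positivity), Complex.real_smul, mul_comm]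

/-- From `|z| / 2 ≤ exp (|z| / 2)`, the integrand is at most `4` times the density of scale `2`. The
first moment controls the error of replacing a jump size by its value at the start of a short
interval. -/
theorem integrable_abs_laplaceMeasure_one : Integrable (fun z : ℝ => |z|) (laplaceMeasure 1) := by
  have h2 := isProbabilityMeasure_laplaceMeasure (b := 2) (by norm_num)
  have hi : Integrable (fun z : ℝ => Real.exp (-|z| / 2) / (2 * 2)) := by
    refine ⟨by fun_prop, ?_⟩
    rw [hasFiniteIntegral_iff_ofReal (Filter.Eventually.of_forall fun z => by positivity)]
    have := measure_lt_top (laplaceMeasure 2) univ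
    rwa [laplaceMeasure, withDensity_apply _ MeasurableSet.univ, setLIntegral_univ] at this
  rw [laplaceMeasure, integrable_withDensity_iff (measurable_laplaceDensity 1)
    (Filter.Eventually.of_forall fun _ => ENNReal.ofReal_lt_top)]
  refine (hi.const_mul 4).mono' (by fun_prop) (Filter.Eventually.of_forall fun z => ?_)
  rw [ENNReal.toReal_ofReal (by positivity), Real.norm_of_nonneg (by positivity)]
  have e1 : |z| / 2 ≤ Real.exp (|z| / 2) := by linarith [Real.add_one_le_exp (|z| / 2)]
  have e2 : Real.exp (|z| / 2) * Real.exp (-|z| / 1) = Real.exp (-|z| / 2) := by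
    rw [← Real.exp_add]
    congr 1
    ring
  calc |z| * (Real.exp (-|z| / 1) / (2 * 1)) = |z| / 2 * Real.exp (-|z| / 1) := by ring
    _ ≤ Real.exp (|z| / 2) * Real.exp (-|z| / 1) := by gcongr
    _ = 4 * (Real.exp (-|z| / 2) / (2 * 2)) := by
        rw [e2]
        ring

/-- Shifting a Laplace variable of scale `b` by `c` changes expectations by a factor of at most
`exp (c / b)`. -/
theorem lintegral_laplaceMeasure_le_shift {b c : ℝ} (hb : 0 < b) (hc : 0 ≤ c) {f : ℝ → ℝ≥0∞}
    (hf : Measurable f) :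
    ∫⁻ z, f z ∂(laplaceMeasure b)
      ≤ ENNReal.ofReal (Real.exp (c / b)) * ∫⁻ z, f (z - c) ∂(laplaceMeasure b) := by
  have hf' : Measurable fun z => f (z - c) := hf.comp (measurable_id.sub_const c)
  rw [laplaceMeasure, lintegral_withDensity_eq_lintegral_mul _ (measurable_laplaceDensity b) hf,
    lintegral_withDensity_eq_lintegral_mul _ (measurable_laplaceDensity b) hf',
    ← lintegral_const_mul' _ _ ENNReal.ofReal_ne_top,
    ← lintegral_sub_right_eq_self _ c]
  refine lintegral_mono fun z => ?_
  simp only [Pi.mul_apply]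
  rw [← mul_assoc, ← ENNReal.ofReal_mul (by positivity)]
  gcongr
  rw [← mul_div_assoc, ← Real.exp_add, ← add_div]
  gcongr
  have := abs_sub_abs_le_abs_sub z (z - c)
  rw [sub_sub_cancel, abs_of_nonneg hc] at this
  linarith

/-! ### Counting paths and their jump times -/

/-- Nondecreasing right-continuous paths on `[t, ∞)` with values in `ℕ`. -/
structure IsCountingPath (t : ℝ) (p : ℝ → ℕ) : Prop where
  mono : MonotoneOn p (Ici t)
  right_cont : ∀ s, t ≤ s → ContinuousWithinAt p (Ici s) s

/-- By right-continuity the path is constant just after the infimum, so the infimum is attained. The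
condition `t ≤ jumpTime` says that the jump happens at all: otherwise the infimum of the empty set
is `0 < t`. -/
theorem IsCountingPath.succ_le_iff {t : ℝ} {p : ℝ → ℕ} (hp : IsCountingPath t p) (ht : 0 < t)
    {s : ℝ} (hs : t ≤ s) (n : ℕ) :
    n + 1 ≤ p s ↔ t ≤ jumpTime t p (n + 1) ∧ jumpTime t p (n + 1) ≤ s := by
  set S := {r : ℝ | t ≤ r ∧ n + 1 ≤ p r} with hS
  have hT : jumpTime t p (n + 1) = sInf S := rfl
  have hbdd : BddBelow S := ⟨t, fun r hr => hr.1⟩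
  rw [hT]
  constructor
  · intro h
    exact ⟨le_csInf ⟨s, hs, h⟩ fun r hr => hr.1, csInf_le hbdd ⟨hs, h⟩⟩
  · rintro ⟨h1, h2⟩
    have hne : S.Nonempty := by
      rw [nonempty_iff_ne_empty]
      intro h
      rw [h, Real.sInf_empty] at h1
      exact absurd h1 (not_le.2 ht)
    have hev : ∀ᶠ r in nhdsWithin (sInf S) (Ici (sInf S)), p r = p (sInf S) := by
      have := hp.right_cont _ h1
      rwa [ContinuousWithinAt, nhds_discrete, Filter.tendsto_pure] at this
    obtain ⟨v, hv, hvS⟩ := (mem_nhdsGE_iff_exists_Ico_subset).1 hev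
    obtain ⟨r, hr, hrv⟩ := exists_lt_of_csInf_lt hne hv
    have h3 : p r = p (sInf S) := hvS ⟨csInf_le hbdd hr, hrv⟩
    calc n + 1 ≤ p r := hr.2
      _ = p (sInf S) := h3
      _ ≤ p s := hp.mono h1 hs h2

/-- Countably many times decide whether the jump ever happens, so this event is measurable. -/
theorem IsCountingPath.le_jumpTime_iff {t : ℝ} {p : ℝ → ℕ} (hp : IsCountingPath t p) (ht : 0 < t)
    (n : ℕ) : t ≤ jumpTime t p (n + 1) ↔ ∃ k : ℕ, n + 1 ≤ p (t + k) := by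
  constructor
  · intro h
    obtain ⟨k, hk⟩ := exists_nat_ge (jumpTime t p (n + 1) - t)
    exact ⟨k, (hp.succ_le_iff ht (by simp) n).2 ⟨h, by linarith⟩⟩
  · rintro ⟨k, hk⟩
    exact ((hp.succ_le_iff ht (by simp) n).1 hk).1

theorem jumpTime_succ_eq_zero {t : ℝ} {p : ℝ → ℕ} {n : ℕ} (h : ¬ t ≤ jumpTime t p (n + 1)) :
    jumpTime t p (n + 1) = 0 := by
  rcases eq_empty_or_nonempty {r : ℝ | t ≤ r ∧ n + 1 ≤ p r} with he | hne
  · change sInf {r : ℝ | t ≤ r ∧ n + 1 ≤ p r} = 0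
    rw [he, Real.sInf_empty]
  · exact absurd (le_csInf hne fun r hr => hr.1) h

theorem measurable_jumpTime {Ω : Type*} [MeasurableSpace Ω] {t : ℝ} (ht : 0 < t)
    {Q : ℝ → Ω → ℕ} (hQ : ∀ ω, IsCountingPath t fun s => Q s ω)
    (hm : ∀ s, t ≤ s → Measurable (Q s)) (n : ℕ) :
    Measurable fun ω => jumpTime t (fun s => Q s ω) n := by
  cases n with
  | zero => exact measurable_const
  | succ n =>
    refine measurable_of_Iic fun s => ?_
    have hle : ∀ s, t ≤ s → MeasurableSet {ω | n + 1 ≤ Q s ω} := fun s hs =>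
      measurableSet_le measurable_const (hm s hs)
    have hB : MeasurableSet {ω | ∃ k : ℕ, n + 1 ≤ Q (t + k) ω} := by
      rw [ofPred_exists]
      exact MeasurableSet.iUnion fun k => hle _ (by simp)
    have : (fun ω => jumpTime t (fun s => Q s ω) (n + 1)) ⁻¹' Iic s
        = ({ω | ∃ k : ℕ, n + 1 ≤ Q (t + k) ω}ᶜ ∩ {_ω | 0 ≤ s})
          ∪ ({ω | ∃ k : ℕ, n + 1 ≤ Q (t + k) ω} ∩ {ω | t ≤ s ∧ n + 1 ≤ Q s ω}) := by
      ext ω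
      have h1 := (hQ ω).le_jumpTime_iff ht n
      simp only [mem_preimage, mem_Iic, mem_union, mem_inter_iff, mem_compl_iff, mem_ofPred_eq]
      rw [← h1]
      by_cases h : t ≤ jumpTime t (fun s => Q s ω) (n + 1)
      · simp only [h, not_true_eq_false, false_and, true_and, false_or]
        constructor
        · exact fun h2 => ⟨h.trans h2, ((hQ ω).succ_le_iff ht (h.trans h2) n).2 ⟨h, h2⟩⟩
        · exact fun h2 => (((hQ ω).succ_le_iff ht h2.1 n).1 h2.2).2
      · simp only [h, not_false_eq_true, true_and, false_and, or_false]
        rw [jumpTime_succ_eq_zero h]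
    rw [this]
    refine (hB.compl.inter (MeasurableSet.const _)).union (hB.inter ?_)
    by_cases hs : t ≤ s
    · simpa [hs] using hle s hs
    · simp [hs]

/-- Joint measurability is needed because the mechanism reads the process at a random time. Level
sets are comparisons of the time with a jump time, which depends on `ω` alone. -/
theorem measurable_uncurry_countingPath {Ω : Type*} [MeasurableSpace Ω] {t : ℝ} (ht : 0 < t)
    {Q : ℝ → Ω → ℕ} (hQ : ∀ ω, IsCountingPath t fun s => Q s ω)
    (hm : ∀ s, t ≤ s → Measurable (Q s)) :
    Measurable fun q : Ici t × Ω => Q q.1 q.2 := by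
  refine measurable_of_Ici fun n => ?_
  cases n with
  | zero => simp
  | succ n =>
    have hT : Measurable fun q : Ici t × Ω => jumpTime t (fun s => Q s q.2) (n + 1) :=
      (measurable_jumpTime ht hQ hm (n + 1)).comp measurable_snd
    have : (fun q : Ici t × Ω => Q q.1 q.2) ⁻¹' Ici (n + 1)
        = {q | t ≤ jumpTime t (fun s => Q s q.2) (n + 1)}
          ∩ {q | jumpTime t (fun s => Q s q.2) (n + 1) ≤ q.1} := by
      ext q
      exact (hQ q.2).succ_le_iff ht q.1.2 n
    rw [this]
    exact (measurableSet_le measurable_const hT).inter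
      (measurableSet_le hT (measurable_subtype_coe.comp measurable_fst))

theorem measurable_uncurry_laplacePath {Ω : Type*} [MeasurableSpace Ω] {t : ℝ} (ht : 0 < t)
    {Q : ℝ → Ω → ℕ} (hQ : ∀ ω, IsCountingPath t fun s => Q s ω)
    (hm : ∀ s, t ≤ s → Measurable (Q s)) {l : ℕ → Ω → ℝ} (hl : ∀ n, Measurable (l n)) :
    Measurable fun q : Ici t × Ω => laplacePath t (fun s => Q s q.2) (fun n => l n q.2) q.1 := by
  have h : ∀ n, Measurable fun ω => jumpTime t (fun s => Q s ω) n * l n ω := fun n =>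
    (measurable_jumpTime ht hQ hm n).mul (hl n)
  obtain ⟨F, hF⟩ : ∃ F : ℕ × Ω → ℝ, F = fun q =>
    ∑ n ∈ Finset.range (q.1 + 1), jumpTime t (fun s => Q s q.2) n * l n q.2 := ⟨_, rfl⟩
  have h1 : Measurable F := by
    refine measurable_from_prod_countable_right fun k => ?_
    simp only [hF]
    fun_prop
  have h2 : (fun q : Ici t × Ω => laplacePath t (fun s => Q s q.2) (fun n => l n q.2) q.1)
      = fun q => F (Q q.1 q.2, q.2) := by
    rw [hF]
    rfl
  rw [h2]
  exact h1.comp ((measurable_uncurry_countingPath ht hQ hm).prodMk measurable_snd)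

theorem measurable_laplacePath {Ω : Type*} [MeasurableSpace Ω] {η : ℝ} (hη : 0 < η)
    {N : ℝ → Ω → ℕ} (hN : ∀ ω, IsCountingPath η fun s => N s ω)
    (hm : ∀ s, η ≤ s → Measurable (N s)) {l : ℕ → Ω → ℝ} (hl : ∀ n, Measurable (l n)) {t : ℝ}
    (ht : η ≤ t) : Measurable fun ω => laplacePath η (fun s => N s ω) (fun n => l n ω) t := by
  obtain ⟨G, hG⟩ : ∃ G : Ici η × Ω → ℝ, G = fun q =>
    laplacePath η (fun s => N s q.2) (fun n => l n q.2) q.1 := ⟨_, rfl⟩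
  have h1 : Measurable G := by
    rw [hG]
    exact measurable_uncurry_laplacePath hη hN hm hl
  have h2 : (fun ω => laplacePath η (fun s => N s ω) (fun n => l n ω) t)
      = fun ω => G (⟨t, ht⟩, ω) := by
    rw [hG]
  rw [h2]
  exact h1.comp measurable_prodMk_left

/-- The path of increments after time `t`. -/
theorem IsCountingPath.sub {η t : ℝ} {p : ℝ → ℕ} (hp : IsCountingPath η p) (ht : η ≤ t) :
    IsCountingPath t fun s => p s - p t where
  mono := fun _ hr _ hs hrs =>
    Nat.sub_le_sub_right (hp.mono (ht.trans hr) (ht.trans hs) hrs) _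
  right_cont := fun s hs =>
    (continuous_of_discreteTopology (f := fun k : ℕ => k - p t)).continuousAt.comp_continuousWithinAt
      (hp.right_cont s (ht.trans hs))

/-- The path stopped at time `t`. -/
theorem IsCountingPath.stopped {η t : ℝ} {p : ℝ → ℕ} (hp : IsCountingPath η p) (ht : η ≤ t) :
    IsCountingPath η fun s => p (min s t) where
  mono := fun _ hr _ hs hrs =>
    hp.mono (le_min hr ht) (le_min hs ht) (min_le_min_right t hrs)
  right_cont := fun s hs => by
    refine ContinuousWithinAt.comp (g := p) (f := fun r => min r t) (t := Ici (min s t))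
      (hp.right_cont _ (le_min hs ht)) ?_ ?_
    · exact (continuous_id.min continuous_const).continuousWithinAt
    · exact fun r hr => min_le_min_right t hr

theorem IsCountingPath.jumpTime_sub {η t : ℝ} {p : ℝ → ℕ} (hp : IsCountingPath η p) (ht : η ≤ t)
    (j : ℕ) : jumpTime t (fun s => p s - p t) (j + 1) = jumpTime η p (p t + j + 1) := by
  change sInf _ = sInf _
  congr 1
  ext r
  simp only [mem_ofPred_eq]
  constructor
  · rintro ⟨h1, h2⟩
    exact ⟨ht.trans h1, by omega⟩
  · rintro ⟨h1, h2⟩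
    refine ⟨?_, by omega⟩
    by_contra hlt
    have := hp.mono h1 ht (not_le.1 hlt).le
    omega

/-- Jump times up to `t` are functionals of the path up to `t`; hence so is every scale occurring in
`Z_t`. -/
theorem IsCountingPath.jumpTime_stopped {η t : ℝ} {p : ℝ → ℕ} (hp : IsCountingPath η p)
    (hη : 0 < η) (ht : η ≤ t) {n : ℕ} (hn : n ≤ p t) :
    jumpTime η (fun s => p (min s t)) n = jumpTime η p n := by
  cases n with
  | zero => rfl
  | succ n =>
    have h1 := (hp.succ_le_iff hη ht n).1 hn
    have h2 := ((hp.stopped ht).succ_le_iff hη ht n).1 (by simpa using hn)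
    apply le_antisymm
    · refine (((hp.stopped ht).succ_le_iff hη h1.1 n).1 ?_).2
      rw [min_eq_left h1.2]
      exact (hp.succ_le_iff hη h1.1 n).2 ⟨h1.1, le_rfl⟩
    · refine ((hp.succ_le_iff hη h2.1 n).1 ?_).2
      have := ((hp.stopped ht).succ_le_iff hη h2.1 n).2 ⟨h2.1, le_rfl⟩
      rwa [min_eq_left h2.2] at this

theorem IsCountingPath.laplacePath_eq_add {η t s : ℝ} {p : ℝ → ℕ} (hp : IsCountingPath η p)
    (ht : η ≤ t) (hs : t ≤ s) (l : ℕ → ℝ) :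
    laplacePath η p l s = laplacePath η p l t
      + ∑ j ∈ Finset.range (p s - p t), jumpTime η p (p t + j + 1) * l (p t + 1 + j) := by
  obtain ⟨d, hd⟩ := Nat.exists_eq_add_of_le (hp.mono ht (ht.trans hs) hs)
  rw [laplacePath, laplacePath, hd, Nat.add_sub_cancel_left, add_right_comm, Finset.sum_range_add]
  congr 1
  refine Finset.sum_congr rfl fun j _ => ?_
  rw [add_right_comm]

/-! ### Independence of the past and the future of the Laplace process -/

theorem IsPoissonProcess.isCountingPath {Ω : Type*} [MeasurableSpace Ω] {η : ℝ} {lam : ℝ → ℝ}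
    {N : ℝ → Ω → ℕ} {μ : Measure Ω} (hN : IsPoissonProcess η lam N μ) (ω : Ω) :
    IsCountingPath η fun s => N s ω :=
  ⟨hN.mono ω, hN.right_cont ω⟩

/-- Independence of increments is used along monotone sequences of times, so finitely many times
have to be put into one. Capping the index makes the sequence constant after its last value. -/
theorem Finset.exists_monotone_enumeration {T : Type*} [LinearOrder T] (A : Finset T) {b : T}
    (hb : ∀ a ∈ A, b ≤ a) :
    ∃ (n : ℕ) (τ : ℕ → T), Monotone τ ∧ τ 0 = b ∧ ∀ a ∈ A, ∃ i ≤ n, τ i = a := by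
  have hc : 0 < (insert b A).card := Finset.card_pos.2 (Finset.insert_nonempty b A)
  set c := (insert b A).card with hcdef
  set e := (insert b A).orderEmbOfFin hcdef.symm with he
  have hlt : ∀ i : ℕ, min i (c - 1) < c := fun i => by omega
  have hmono : Monotone fun i : ℕ => e ⟨min i (c - 1), hlt i⟩ := fun i j hij =>
    e.monotone (Fin.mk_le_mk.2 (min_le_min_right _ hij))
  have hsurj : ∀ a ∈ insert b A, ∃ i ≤ c, e ⟨min i (c - 1), hlt i⟩ = a := by
    intro a ha
    have : a ∈ Set.range e := by
      rw [he, Finset.range_orderEmbOfFin]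
      exact ha
    obtain ⟨i, rfl⟩ := this
    refine ⟨i, i.2.le, congrArg e (Fin.ext ?_)⟩
    have := i.2
    simp only
    omega
  refine ⟨c, _, hmono, le_antisymm ?_ ?_, fun a ha => hsurj a (Finset.mem_insert_of_mem ha)⟩
  · obtain ⟨i, -, hi⟩ := hsurj b (Finset.mem_insert_self b A)
    exact (hmono (Nat.zero_le i)).trans_eq hi
  · have : e ⟨min 0 (c - 1), hlt 0⟩ ∈ insert b A := Finset.orderEmbOfFin_mem _ _ _
    rcases Finset.mem_insert.1 this with h | h
    · exact h.ge
    · exact hb _ h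

theorem sum_Ico_increments {T : Type*} [Preorder T] {q : T → ℕ} (hq : Monotone q) {τ : ℕ → T}
    (hτ : Monotone τ) {k i : ℕ} (hki : k ≤ i) :
    ∑ j ∈ Finset.Ico k i, (q (τ (j + 1)) - q (τ j)) = q (τ i) - q (τ k) := by
  induction i, hki using Nat.le_induction with
  | base => simp
  | succ i hi ih =>
    rw [Finset.sum_Ico_succ_top hi, ih]
    have h1 : q (τ k) ≤ q (τ i) := hq (hτ hi)
    have h2 : q (τ i) ≤ q (τ (i + 1)) := hq (hτ (Nat.le_succ i))
    omega

/-- It suffices to treat finitely many times. List them in order together with `η` and `t`. As the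
path starts at `0`, past values are sums of consecutive increments before `t`, and future ones are
sums after `t`; disjoint blocks of increments are independent. -/
theorem IsPoissonProcess.indepFun_past_future {Ω : Type*} [MeasurableSpace Ω] {η : ℝ}
    {lam : ℝ → ℝ} {N : ℝ → Ω → ℕ} {μ : Measure Ω} [IsProbabilityMeasure μ]
    (hN : IsPoissonProcess η lam N μ) {t : ℝ} (ht : η ≤ t) :
    IndepFun (fun ω (r : Ici η) => N (min r t) ω) (fun ω (r : Ici t) => N r ω - N t ω) μ := by
  refine IndepFun.process_indepFun_process (fun r => hN.measurable _ (le_min r.2 ht))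
    (fun r => (hN.measurable _ (ht.trans r.2)).sub (hN.measurable _ ht)) fun I J => ?_
  let t₀ : Ici η := ⟨t, ht⟩
  let η₀ : Ici η := ⟨η, self_mem_Ici⟩
  let incl : Ici t → Ici η := fun r => ⟨r, ht.trans r.2⟩
  obtain ⟨n, τ, hτ, hτ0, hsurj⟩ := Finset.exists_monotone_enumeration
    (insert t₀ (I.image (fun r => min r t₀) ∪ J.image incl)) (b := η₀) (fun a _ => a.2)
  obtain ⟨k, hkn, hk⟩ := hsurj t₀ (Finset.mem_insert_self _ _)
  have hI : ∀ r : I, ∃ i ≤ k, τ i = min (r : Ici η) t₀ := by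
    intro r
    obtain ⟨i, -, hi⟩ := hsurj (min (r : Ici η) t₀) (Finset.mem_insert_of_mem
      (Finset.mem_union_left _ (Finset.mem_image_of_mem _ r.2)))
    rcases le_total i k with hik | hki
    · exact ⟨i, hik, hi⟩
    · refine ⟨k, le_rfl, le_antisymm ((hτ hki).trans_eq hi) ?_⟩
      rw [hk]
      exact min_le_right _ _
  have hJ : ∀ r : J, ∃ i, k ≤ i ∧ i ≤ n ∧ τ i = incl r := by
    intro r
    obtain ⟨i, hin, hi⟩ := hsurj (incl r) (Finset.mem_insert_of_mem
      (Finset.mem_union_right _ (Finset.mem_image_of_mem _ r.2)))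
    rcases le_total k i with hki | hik
    · exact ⟨i, hki, hin, hi⟩
    · refine ⟨k, le_rfl, hkn, le_antisymm ?_ ((hi.symm.trans_le (hτ hik)))⟩
      rw [hk]
      exact r.1.2
  choose iI hiIk hiI using hI
  choose iJ hkiJ hiJn hiJ using hJ
  have hmono : ∀ ω, Monotone fun r : Ici η => N r ω := fun ω a b hab => hN.mono ω a.2 b.2 hab
  have hD : iIndepFun (fun i ω => N (τ (i + 1)) ω - N (τ i) ω) μ :=
    HasIndepIncrements.nat hN.indep hτ
  have hDm : ∀ i, Measurable fun ω => N (τ (i + 1)) ω - N (τ i) ω := fun i =>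
    (hN.measurable _ (τ (i + 1)).2).sub (hN.measurable _ (τ i).2)
  have hind := hD.indepFun_finset (Finset.Ico 0 k) (Finset.Ico k n)
    (Finset.Ico_disjoint_Ico_consecutive 0 k n) hDm
  let φ : (Finset.Ico 0 k → ℕ) → I → ℕ := fun d r =>
    ∑ j ∈ Finset.univ.filter (fun j : Finset.Ico 0 k => (j : ℕ) < iI r), d j
  let ψ : (Finset.Ico k n → ℕ) → J → ℕ := fun d r =>
    ∑ j ∈ Finset.univ.filter (fun j : Finset.Ico k n => (j : ℕ) < iJ r), d j
  have hφ : Measurable φ := by fun_prop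
  have hψ : Measurable ψ := by fun_prop
  have aux : ∀ (a b i : ℕ) (_ : i ≤ b) (g : ℕ → ℕ),
      ∑ j ∈ Finset.univ.filter (fun j : Finset.Ico a b => (j : ℕ) < i), g j
        = ∑ j ∈ Finset.Ico a i, g j := by
    intro a b i hi g
    rw [Finset.sum_filter, Finset.sum_coe_sort (Finset.Ico a b) fun j => if j < i then g j else 0,
      ← Finset.sum_filter]
    congr 1
    ext j
    simp only [Finset.mem_filter, Finset.mem_Ico]
    omega
  convert! hind.comp hφ hψ using 1
  · funext ω r
    simp only [Function.comp_def, φ]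
    rw [aux 0 k (iI r) (hiIk r) fun j => N (τ (j + 1)) ω - N (τ j) ω,
      sum_Ico_increments (hmono ω) hτ (Nat.zero_le _), hiI r, hτ0, hN.init ω, Nat.sub_zero]
    rfl
  · funext ω r
    simp only [Function.comp_def, ψ]
    rw [aux k n (iJ r) (hiJn r) fun j => N (τ (j + 1)) ω - N (τ j) ω,
      sum_Ico_increments (hmono ω) hτ (hkiJ r), hiJ r, hk]

/-- Asks only for measurability in the generated σ-algebras. This suits jump times, whose
measurability rests on path properties that fail at general points of the product space. -/
theorem ProbabilityTheory.IndepFun.of_measurable_comap {Ω α β γ δ : Type*} [MeasurableSpace Ω]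
    [mα : MeasurableSpace α] [mβ : MeasurableSpace β] {_ : MeasurableSpace γ} {_ : MeasurableSpace δ}
    {μ : Measure Ω} {A : Ω → α} {B : Ω → β} {f : Ω → γ} {g : Ω → δ} (h : IndepFun A B μ)
    (hf : Measurable[mα.comap A] f) (hg : Measurable[mβ.comap B] g) : IndepFun f g μ := by
  rw [IndepFun_iff_Indep] at *
  exact indep_of_indep_of_le_left (indep_of_indep_of_le_right h hg.comap_le) hf.comap_le

/-- The increments and the jump times after time `t`. -/
def futureJumps {Ω : Type*} (η t : ℝ) (N : ℝ → Ω → ℕ) (ω : Ω) : (Ici t → ℕ) × (ℕ → ℝ) :=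
  (fun r => N r ω - N t ω, fun j => jumpTime η (fun s => N s ω) (N t ω + j + 1))

/-- The marks of the jumps after time `t`. -/
def futureMarks {Ω : Type*} (t : ℝ) (N : ℝ → Ω → ℕ) (l : ℕ → Ω → ℝ) (ω : Ω) : ℕ → ℝ :=
  fun j => l (N t ω + 1 + j) ω

theorem measurable_futureJumps {Ω : Type*} [MeasurableSpace Ω] {η t : ℝ} {N : ℝ → Ω → ℕ}
    (hη : 0 < η) (ht : η ≤ t) (hN : ∀ ω, IsCountingPath η fun s => N s ω)
    (hm : ∀ s, t ≤ s → Measurable fun ω => N s ω - N t ω) : Measurable (futureJumps η t N) := by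
  refine Measurable.prodMk (measurable_pi_lambda _ fun s => hm s s.2)
    (measurable_pi_lambda _ fun j => ?_)
  simp_rw [← (hN _).jumpTime_sub ht]
  exact measurable_jumpTime (hη.trans_le ht) (Q := fun s ω => N s ω - N t ω)
    (fun ω => (hN ω).sub ht) hm (j + 1)

theorem measurable_futureMarks {Ω : Type*} [MeasurableSpace Ω] {t : ℝ} {N : ℝ → Ω → ℕ}
    {l : ℕ → Ω → ℝ} (hN : Measurable (N t)) (hl : ∀ n, Measurable (l n)) :
    Measurable (futureMarks t N l) :=
  measurable_pi_lambda _ fun j =>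
    (measurable_from_prod_countable_right (f := fun q : ℕ × Ω => l (q.1 + 1 + j) q.2)
      fun k => hl (k + 1 + j)).comp (hN.prodMk measurable_id)

theorem IsStdLaplaceSeq.map_shift {Ω : Type*} [MeasurableSpace Ω] {μ : Measure Ω}
    {l : ℕ → Ω → ℝ} (hl : IsStdLaplaceSeq l μ) (m : ℕ) :
    μ.map (fun ω j => l (m + j) ω) = Measure.infinitePi fun _ : ℕ => laplaceMeasure 1 :=
  (iIndepFun.hasLaw_infinitePi (fun j => hl.law (m + j))
    (hl.indep.precomp (g := fun j => m + j) (fun _ _ h => Nat.add_left_cancel h))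
    (measurable_pi_lambda _ fun j => hl.measurable (m + j)).aemeasurable).map_eq

theorem iIndepFun_nat_indepFun_shift {Ω : Type*} [MeasurableSpace Ω] {μ : Measure Ω}
    [IsProbabilityMeasure μ] {l : ℕ → Ω → ℝ} (hl : iIndepFun l μ) (hm : ∀ n, Measurable (l n))
    (m : ℕ) :
    IndepFun (fun ω (i : Finset.range m) => l i ω) (fun ω j => l (m + j) ω) μ := by
  refine IndepFun.indepFun_process (measurable_pi_lambda _ fun i => hm i) (fun j => hm (m + j))
    fun J => ?_
  have h := hl.indepFun_finset (Finset.range m) (J.map (addLeftEmbedding m)) ?_ hm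
  · exact h.comp measurable_id (φ := id) (ψ := fun a (j : J) =>
      a ⟨m + j, Finset.mem_map_of_mem (addLeftEmbedding m) j.2⟩) (by fun_prop)
  · rw [Finset.disjoint_left]
    intro i hi hi'
    obtain ⟨j, -, rfl⟩ := Finset.mem_map.1 hi'
    simp at hi

/-- On `{N t = m}`, `Z_t` is a function of the stopped path and the marks `0, …, m`, while the
future uses later increments and the marks from `m + 1` on. For fixed `m` these are independent, and
the law of the future does not depend on `m`, so `m` may be replaced by `N t`. -/
theorem laplacePath_indepFun_future {Ω : Type*} [MeasurableSpace Ω] {η : ℝ}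
    {lam : ℝ → ℝ} {N : ℝ → Ω → ℕ} {μ : Measure Ω} [IsProbabilityMeasure μ] {l : ℕ → Ω → ℝ}
    (hη : 0 < η) (hN : IsPoissonProcess η lam N μ) (hl : IsStdLaplaceSeq l μ)
    (hind : IndepFun (fun ω (t : Ici η) => N t ω) (fun ω n => l n ω) μ) {t : ℝ} (ht : η ≤ t) :
    Measurable (futureJumps η t N) ∧ Measurable (futureMarks t N l) ∧
    IndepFun (fun ω => laplacePath η (fun s => N s ω) (fun n => l n ω) t)
      (fun ω => (futureJumps η t N ω, futureMarks t N l ω)) μ ∧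
    μ.map (fun ω => (futureJumps η t N ω, futureMarks t N l ω))
      = (μ.map (futureJumps η t N)).prod (Measure.infinitePi fun _ => laplaceMeasure 1) := by
  have hcp := hN.isCountingPath
  let A : Ω → Ici η → ℕ := fun ω r => N (min r t) ω
  let B : Ω → Ici t → ℕ := fun ω r => N r ω - N t ω
  let C : Ω → Ici η → ℕ := fun ω r => N r ω
  have hA : ∀ s, η ≤ s → Measurable[MeasurableSpace.pi.comap A] fun ω => N (min s t) ω :=
    fun s hs => (measurable_pi_apply (⟨s, hs⟩ : Ici η)).comp (comap_measurable A)
  have hB : ∀ s, t ≤ s → Measurable[MeasurableSpace.pi.comap B] fun ω => N s ω - N t ω :=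
    fun s hs => (measurable_pi_apply (⟨s, hs⟩ : Ici t)).comp (comap_measurable B)
  have hC : ∀ s, η ≤ s → Measurable[MeasurableSpace.pi.comap C] (N s) :=
    fun s hs => (measurable_pi_apply (⟨s, hs⟩ : Ici η)).comp (comap_measurable C)
  have hAC : MeasurableSpace.pi.comap A ≤ MeasurableSpace.pi.comap C :=
    Measurable.comap_le (@measurable_pi_lambda _ _ _ (MeasurableSpace.pi.comap C) _ _
      fun r => hC _ (le_min r.2 ht))
  have hBC : MeasurableSpace.pi.comap B ≤ MeasurableSpace.pi.comap C :=
    Measurable.comap_le (@measurable_pi_lambda _ _ _ (MeasurableSpace.pi.comap C) _ _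
      fun r => (hC _ (ht.trans r.2)).sub (hC _ ht))
  have hCm : MeasurableSpace.pi.comap C ≤ ‹MeasurableSpace Ω› :=
    Measurable.comap_le (measurable_pi_lambda _ fun r => hN.measurable _ r.2)
  let V : Ω → ℕ × (ℕ → ℝ) := fun ω => (N t ω, fun n => jumpTime η (fun s => N (min s t) ω) n)
  let U := futureJumps η t N
  have hV : Measurable[MeasurableSpace.pi.comap A] V := by
    refine Measurable.prodMk ?_ ?_
    · simpa using hA t ht
    · exact @measurable_pi_lambda _ _ _ (MeasurableSpace.pi.comap A) _ _ fun n =>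
        @measurable_jumpTime _ (MeasurableSpace.pi.comap A) _ hη (fun s ω => N (min s t) ω)
          (fun ω => (hcp ω).stopped ht) hA n
  have hU : Measurable[MeasurableSpace.pi.comap B] U :=
    @measurable_futureJumps _ (MeasurableSpace.pi.comap B) _ _ _ hη ht hcp hB
  have hVU : IndepFun V U μ := (hN.indepFun_past_future ht).of_measurable_comap hV hU
  have hVm : Measurable V := hV.mono (hAC.trans hCm) le_rfl
  have hUm : Measurable U := hU.mono (hBC.trans hCm) le_rfl
  let L : ℕ → Ω → ℕ → ℝ := fun m ω j => l (m + 1 + j) ω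
  have hLm : ∀ m, Measurable (L m) := fun m => measurable_pi_lambda _ fun j => hl.measurable _
  have hlc : ∀ n, Measurable[MeasurableSpace.pi.comap fun ω n => l n ω] (l n) := fun n =>
    (measurable_pi_apply n).comp (comap_measurable fun ω n => l n ω)
  have h4 : ∀ m, IndepFun (fun ω => (V ω, U ω))
      (fun ω => ((fun i : Finset.range (m + 1) => l i ω), L m ω)) μ := fun m =>
    hind.of_measurable_comap ((hV.mono hAC le_rfl).prodMk (hU.mono hBC le_rfl))
      ((@measurable_pi_lambda _ _ _ (MeasurableSpace.pi.comap fun ω n => l n ω) _ _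
        fun i => hlc _).prodMk (@measurable_pi_lambda _ _ _
          (MeasurableSpace.pi.comap fun ω n => l n ω) _ _ fun i => hlc _))
  have h5 : ∀ m, IndepFun (fun ω => (V ω, fun i : Finset.range (m + 1) => l i ω))
      (fun ω => (U ω, L m ω)) μ := fun m =>
    indepFun_prodMk_prodMk_of_indepFun hVm hUm
      (measurable_pi_lambda _ fun i => hl.measurable i) (hLm m) hVU
      (iIndepFun_nat_indepFun_shift hl.indep hl.measurable (m + 1)) (h4 m)
  -- The count `N t` is kept beside the sum, because the future must be independent of the index and
  -- the value jointly.
  let φ : ∀ m : ℕ, (ℕ × (ℕ → ℝ)) × (Finset.range (m + 1) → ℝ) → ℕ × ℝ := fun m q =>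
    (q.1.1, ∑ i : Finset.range (m + 1), q.1.2 i * q.2 i)
  have hφ : ∀ m, Measurable (φ m) := fun m => by fun_prop
  let X' : ℕ → Ω → ℝ := fun m ω =>
    ∑ i : Finset.range (m + 1), jumpTime η (fun s => N (min s t) ω) i * l i ω
  have hX' : ∀ m, Measurable (X' m) := fun m =>
    (measurable_snd.comp (hφ m)).comp (hVm.prodMk (measurable_pi_lambda _ fun i => hl.measurable i))
  obtain ⟨-, h2, h3, h6⟩ := indepFun_of_random_index (K := N t)
    (X := fun ω => laplacePath η (fun s => N s ω) (fun n => l n ω) t)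
    (Y := fun ω => (U ω, futureMarks t N l ω)) (X' := X')
    (Y' := fun m ω => (U ω, L m ω))
    (ν := (μ.map U).prod (Measure.infinitePi fun _ => laplaceMeasure 1))
    (hN.measurable t ht) hX' (fun m => hUm.prodMk (hLm m))
    (fun ω => by
      simp only [X', laplacePath]
      rw [Finset.sum_coe_sort (Finset.range (N t ω + 1))
        fun i => jumpTime η (fun s => N (min s t) ω) i * l i ω]
      refine Finset.sum_congr rfl fun n hn => ?_
      rw [(hcp ω).jumpTime_stopped hη ht (Nat.lt_succ_iff.1 (Finset.mem_range.1 hn))])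
    (fun ω => rfl) (fun m => (h5 m).comp (hφ m) measurable_id)
    (fun m => by
      have hUL : IndepFun U (L m) μ := (h4 m).comp measurable_snd measurable_snd
      rw [(indepFun_iff_map_prod_eq_prod_map_map hUm.aemeasurable (hLm m).aemeasurable).1 hUL,
        hl.map_shift (m + 1)])
  exact ⟨hUm, measurable_snd.comp h2, h3, h6⟩

/-! ### The marginals of the Laplace process -/

theorem norm_cexp_mul_I_sub_cexp_le (θ x y : ℝ) :
    ‖Complex.exp (θ * x * Complex.I) - Complex.exp (θ * y * Complex.I)‖ ≤ |θ| * |x - y| := by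
  have h1 : Complex.exp (θ * x * Complex.I) - Complex.exp (θ * y * Complex.I)
      = Complex.exp ((θ * y : ℝ) * Complex.I)
        * (Complex.exp (Complex.I * ((θ * (x - y) : ℝ) : ℂ)) - 1) := by
    rw [mul_sub, mul_one, ← Complex.exp_add]
    push_cast
    ring_nf
  rw [h1, norm_mul, Complex.norm_exp_ofReal_mul_I, one_mul, ← abs_mul]
  exact Real.norm_exp_I_mul_ofReal_sub_one_le

theorem norm_cexp_mul_I (θ x : ℝ) : ‖Complex.exp (θ * x * Complex.I)‖ = 1 := by
  rw [← Complex.ofReal_mul, Complex.norm_exp_ofReal_mul_I]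

theorem integral_ite_eq {Ω : Type*} [MeasurableSpace Ω] {μ : Measure Ω} {D : Ω → ℕ}
    (hD : Measurable D) (k : ℕ) :
    ∫ ω, (if D ω = k then (1 : ℝ) else 0) ∂μ = μ.real (D ⁻¹' {k}) := by
  rw [← integral_indicator_one (hD (measurableSet_singleton k))]
  refine integral_congr_ae (Filter.Eventually.of_forall fun ω => ?_)
  by_cases h : D ω = k <;> simp [h]

/-- First-order expansion of the characteristic function of a sum of at most one term, up to an
event of small probability. -/
theorem norm_charFun_sub_le_of_single_term {Ω : Type*} [MeasurableSpace Ω] {μ : Measure Ω}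
    [IsProbabilityMeasure μ] {ν : Measure ℝ} {D : Ω → ℕ} {L W : Ω → ℝ} {s t : ℝ}
    (hD : Measurable D) (hL : Measurable L) (hW : Measurable W) (hDL : IndepFun D L μ)
    (hlaw : μ.map L = ν) (hν : Integrable (fun z : ℝ => |z|) ν)
    (h0 : ∀ ω, D ω = 0 → W ω = 0)
    (h1 : ∀ ω, D ω = 1 → ∃ S, t ≤ S ∧ S ≤ s ∧ W ω = S * L ω) (θ : ℝ) :
    ‖charFun (μ.map W) θ - 1 - μ.real (D ⁻¹' {1}) * (charFun ν (t * θ) - 1)‖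
      ≤ |θ| * (s - t) * (μ.real (D ⁻¹' {1}) * ∫ z, |z| ∂ν)
        + 2 * (1 - μ.real (D ⁻¹' {0}) - μ.real (D ⁻¹' {1})) ∧
    ‖charFun (μ.map W) θ - 1‖ ≤ 2 * (1 - μ.real (D ⁻¹' {0})) := by
  let i : ℕ → ℕ → ℝ := fun k n => if n = k then 1 else 0
  have hi : ∀ k, Measurable (i k) := fun k => measurable_from_top
  have hiD : ∀ k, Integrable (fun ω => i k (D ω)) μ := fun k =>
    Integrable.of_bound ((hi k).comp hD).aestronglyMeasurable 1
      (Filter.Eventually.of_forall fun ω => by simp only [i]; split_ifs <;> simp)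
  have hiI : ∀ k, ∫ ω, i k (D ω) ∂μ = μ.real (D ⁻¹' {k}) := integral_ite_eq hD
  have hWi : Integrable (fun ω => Complex.exp (θ * W ω * Complex.I)) μ :=
    Integrable.of_bound (by fun_prop) 1
      (Filter.Eventually.of_forall fun ω => (norm_cexp_mul_I _ _).le)
  have hLi : Integrable (fun ω => Complex.exp ((t * θ : ℝ) * L ω * Complex.I)) μ :=
    Integrable.of_bound (by fun_prop) 1
      (Filter.Eventually.of_forall fun ω => (norm_cexp_mul_I _ _).le)
  have hcW : charFun (μ.map W) θ = ∫ ω, Complex.exp (θ * W ω * Complex.I) ∂μ := by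
    rw [charFun_apply_real, integral_map hW.aemeasurable (by fun_prop)]
  have hcL : charFun ν (t * θ) = ∫ ω, Complex.exp ((t * θ : ℝ) * L ω * Complex.I) ∂μ := by
    rw [charFun_apply_real, ← hlaw, integral_map hL.aemeasurable (by fun_prop)]
  have hmul : ∫ ω, (i 1 (D ω) : ℂ) * (Complex.exp ((t * θ : ℝ) * L ω * Complex.I) - 1) ∂μ
      = μ.real (D ⁻¹' {1}) * (charFun ν (t * θ) - 1) := by
    rw [hDL.integral_fun_comp_mul_comp (f := fun n => (i 1 n : ℂ))
      (g := fun z : ℝ => Complex.exp ((t * θ : ℝ) * z * Complex.I) - 1) hD.aemeasurable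
      hL.aemeasurable (by fun_prop) (by fun_prop), integral_sub hLi (integrable_const _), ← hcL,
      integral_complex_ofReal, hiI]
    simp
  have hmul_int : Integrable (fun ω =>
      (i 1 (D ω) : ℂ) * (Complex.exp ((t * θ : ℝ) * L ω * Complex.I) - 1)) μ :=
    (hLi.sub (integrable_const _)).bdd_mul (c := 1) (by fun_prop)
      (Filter.Eventually.of_forall fun ω => by simp only [i]; split_ifs <;> simp)
  have habsL : Integrable (fun ω => |L ω|) μ := by
    rw [← hlaw] at hν
    exact hν.comp_measurable hL
  have habs_int : Integrable (fun ω => i 1 (D ω) * |L ω|) μ :=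
    habsL.bdd_mul (c := 1) (by fun_prop)
      (Filter.Eventually.of_forall fun ω => by simp only [i]; split_ifs <;> simp)
  have habs : ∫ ω, i 1 (D ω) * |L ω| ∂μ = μ.real (D ⁻¹' {1}) * ∫ z, |z| ∂ν := by
    rw [hDL.integral_fun_comp_mul_comp (f := i 1) (g := fun z : ℝ => |z|) hD.aemeasurable
      hL.aemeasurable (by fun_prop) (by fun_prop), hiI, ← hlaw,
      integral_map hL.aemeasurable (by fun_prop)]
  have hW1 : Integrable (fun ω => Complex.exp (θ * W ω * Complex.I) - 1) μ :=
    hWi.sub (integrable_const 1)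
  have hi0 : Integrable (fun ω => 1 - i 0 (D ω)) μ := (integrable_const 1).sub (hiD 0)
  have hi01 : Integrable (fun ω => 1 - i 0 (D ω) - i 1 (D ω)) μ := hi0.sub (hiD 1)
  constructor
  · have hLHS : charFun (μ.map W) θ - 1 - μ.real (D ⁻¹' {1}) * (charFun ν (t * θ) - 1)
        = ∫ ω, (Complex.exp (θ * W ω * Complex.I) - 1
          - (i 1 (D ω) : ℂ) * (Complex.exp ((t * θ : ℝ) * L ω * Complex.I) - 1)) ∂μ := by
      rw [integral_sub hW1 hmul_int,
        integral_sub hWi (integrable_const _), hmul, hcW]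
      simp
    have hRHS : |θ| * (s - t) * (μ.real (D ⁻¹' {1}) * ∫ z, |z| ∂ν)
        + 2 * (1 - μ.real (D ⁻¹' {0}) - μ.real (D ⁻¹' {1}))
        = ∫ ω, (|θ| * (s - t) * (i 1 (D ω) * |L ω|) + 2 * (1 - i 0 (D ω) - i 1 (D ω))) ∂μ := by
      rw [integral_add (habs_int.const_mul _)
        (hi01.const_mul _), integral_const_mul, integral_const_mul, integral_sub hi0 (hiD 1),
        integral_sub (integrable_const _) (hiD 0), habs, hiI, hiI]
      simp
    rw [hLHS, hRHS]
    refine norm_integral_le_of_norm_le ((habs_int.const_mul _).add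
      (hi01.const_mul _))
      (Filter.Eventually.of_forall fun ω => ?_)
    -- With no term both exponentials are `1`; with one term the phases differ by at most `|θ| (s -
    -- t) |L|`; with two or more, the trivial bound `2` is used.
    rcases Nat.lt_or_ge (D ω) 2 with hlt | hge
    · have h01 : D ω = 0 ∨ D ω = 1 := by omega
      rcases h01 with h | h
      · simp [i, h, h0 ω h]
      · obtain ⟨S, hS1, hS2, hWS⟩ := h1 ω h
        simp only [i, h, hWS, if_true, Complex.ofReal_one, one_mul, sub_sub_sub_cancel_right,
          one_ne_zero, if_false, sub_zero, sub_self, mul_zero, add_zero]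
        have : ((t * θ : ℝ) : ℂ) * (L ω : ℂ) = θ * ((t * L ω : ℝ) : ℂ) := by
          push_cast
          ring
        rw [this]
        refine (norm_cexp_mul_I_sub_cexp_le θ (S * L ω) (t * L ω)).trans ?_
        rw [← sub_mul, abs_mul, abs_of_nonneg (sub_nonneg.2 hS1), ← mul_assoc]
        gcongr
    · have hn0 : D ω ≠ 0 := by omega
      have hn1 : D ω ≠ 1 := by omega
      simp only [i, hn0, hn1, if_false, Complex.ofReal_zero, zero_mul, sub_zero, mul_zero, zero_add]
      refine (norm_sub_le _ _).trans ?_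
      rw [norm_cexp_mul_I, norm_one]
      norm_num
  · have hLHS : charFun (μ.map W) θ - 1 = ∫ ω, (Complex.exp (θ * W ω * Complex.I) - 1) ∂μ := by
      rw [integral_sub hWi (integrable_const _), hcW]
      simp
    have hRHS : 2 * (1 - μ.real (D ⁻¹' {0})) = ∫ ω, 2 * (1 - i 0 (D ω)) ∂μ := by
      rw [integral_const_mul, integral_sub (integrable_const _) (hiD 0), hiI]
      simp
    rw [hLHS, hRHS]
    refine norm_integral_le_of_norm_le (hi0.const_mul _)
      (Filter.Eventually.of_forall fun ω => ?_)
    by_cases h : D ω = 0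
    · simp [i, h, h0 ω h]
    · simp only [i, h, if_false, sub_zero]
      refine (norm_sub_le _ _).trans ?_
      rw [norm_cexp_mul_I, norm_one]
      norm_num

theorem IsPoissonProcess.measureReal_increment {Ω : Type*} [MeasurableSpace Ω] {η : ℝ}
    (hη : 0 < η) {N : ℝ → Ω → ℕ} {μ : Measure Ω} [IsProbabilityMeasure μ]
    (hN : IsPoissonProcess η (fun t => 2 / t) N μ) {s t : ℝ} (ht : η ≤ t) (hs : t ≤ s) :
    μ.real ((fun ω => N s ω - N t ω) ⁻¹' {0}) = (t / s) ^ 2 ∧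
    μ.real ((fun ω => N s ω - N t ω) ⁻¹' {1}) = 2 * Real.log (s / t) * (t / s) ^ 2 := by
  have ht0 : 0 < t := hη.trans_le ht
  have hs0 : 0 < s := ht0.trans_le hs
  have hint : ∫ r in t..s, 2 / r = 2 * Real.log (s / t) := by
    simp_rw [div_eq_mul_inv]
    rw [intervalIntegral.integral_const_mul, integral_inv_of_pos ht0 hs0, div_eq_mul_inv]
  have hlog : 0 ≤ 2 * Real.log (s / t) :=
    mul_nonneg zero_le_two (Real.log_nonneg ((one_le_div ht0).2 hs))
  have hlaw := hN.law t s ht hs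
  rw [hint] at hlaw
  have hexp : Real.exp (-(2 * Real.log (s / t))) = (t / s) ^ 2 := by
    have : -(2 * Real.log (s / t)) = Real.log (t / s) + Real.log (t / s) := by
      rw [← inv_div t s, Real.log_inv]
      ring
    rw [this, Real.exp_add, Real.exp_log (by positivity), sq]
  have hm : Measurable fun ω => N s ω - N t ω :=
    (hN.measurable s (ht.trans hs)).sub (hN.measurable t ht)
  have key : ∀ k, μ.real ((fun ω => N s ω - N t ω) ⁻¹' {k})
      = (poissonMeasure (2 * Real.log (s / t)).toNNReal).real {k} := fun k => by
    rw [← hlaw.map_eq, map_measureReal_apply hm (measurableSet_singleton k)]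
  rw [key, key, poissonMeasure_real_singleton, poissonMeasure_real_singleton,
    Real.coe_toNNReal _ hlog, hexp]
  constructor
  · simp
  · simp
    ring

/-- The increment of the Laplace process from time `t` to time `s`, as a function of the jumps and
marks after time `t`. -/
def futureIncrement (t s : ℝ) (hs : t ≤ s) (q : ((Ici t → ℕ) × (ℕ → ℝ)) × (ℕ → ℝ)) : ℝ :=
  ∑ j ∈ Finset.range (q.1.1 ⟨s, hs⟩), q.1.2 j * q.2 j

theorem measurable_futureIncrement (t s : ℝ) (hs : t ≤ s) :
    Measurable (futureIncrement t s hs) := by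
  obtain ⟨F, hF⟩ : ∃ F : ℕ × ((ℕ → ℝ) × (ℕ → ℝ)) → ℝ, F = fun q =>
    ∑ j ∈ Finset.range q.1, q.2.1 j * q.2.2 j := ⟨_, rfl⟩
  have h1 : Measurable F := by
    refine measurable_from_prod_countable_right fun k => ?_
    simp only [hF]
    fun_prop
  have h2 : futureIncrement t s hs = fun q => F (q.1.1 ⟨s, hs⟩, (q.1.2, q.2)) := by
    rw [hF]
    rfl
  rw [h2]
  exact h1.comp (by fun_prop)

theorem laplacePath_eq_add_futureIncrement {Ω : Type*} [MeasurableSpace Ω] {η : ℝ}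
    {N : ℝ → Ω → ℕ} {μ : Measure Ω} {l : ℕ → Ω → ℝ} {lam : ℝ → ℝ} (hN : IsPoissonProcess η lam N μ)
    {t s : ℝ} (ht : η ≤ t) (hs : t ≤ s) (ω : Ω) :
    laplacePath η (fun s => N s ω) (fun n => l n ω) s
      = laplacePath η (fun s => N s ω) (fun n => l n ω) t
        + futureIncrement t s hs (futureJumps η t N ω, futureMarks t N l ω) :=
  (hN.isCountingPath ω).laplacePath_eq_add ht hs _

section Marginal

variable {Ω : Type*} [MeasurableSpace Ω] {η : ℝ} {N : ℝ → Ω → ℕ} {μ : Measure Ω}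
  [IsProbabilityMeasure μ] {l : ℕ → Ω → ℝ}

/-- The increment is independent of `Z_t`, so `f s` is `f t` times its characteristic function, and
`‖f t‖ ≤ 1`. The second bound gives continuity of `f`, the first its right derivative. -/
theorem charFun_laplacePath_expansion (hη : 0 < η)
    (hN : IsPoissonProcess η (fun t => 2 / t) N μ) (hl : IsStdLaplaceSeq l μ)
    (hind : IndepFun (fun ω (t : Ici η) => N t ω) (fun ω n => l n ω) μ) (θ : ℝ) {f : ℝ → ℂ}
    (hf : ∀ t, f t = charFun
      (μ.map fun ω => laplacePath η (fun s => N s ω) (fun n => l n ω) t) θ)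
    {t s : ℝ} (ht : η ≤ t) (hs : t ≤ s) :
    ‖f s - f t - f t * ((2 * Real.log (s / t) * (t / s) ^ 2 : ℝ) *
        (charFun (laplaceMeasure 1) (t * θ) - 1))‖
      ≤ |θ| * (s - t) * (2 * Real.log (s / t) * (t / s) ^ 2 * ∫ z, |z| ∂(laplaceMeasure 1))
        + 2 * (1 - (t / s) ^ 2 - 2 * Real.log (s / t) * (t / s) ^ 2) ∧
    ‖f s - f t‖ ≤ 2 * (1 - (t / s) ^ 2) := by
  obtain ⟨hU, hL, hZ, hlaw⟩ := laplacePath_indepFun_future hη hN hl hind ht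
  have hUL : IndepFun (futureJumps η t N) (futureMarks t N l) μ ∧
      μ.map (futureMarks t N l) = Measure.infinitePi fun _ => laplaceMeasure 1 := by
    have p1 := Measure.isProbabilityMeasure_map (μ := μ) hU.aemeasurable
    have h2 : μ.map (futureMarks t N l) = Measure.infinitePi fun _ => laplaceMeasure 1 := by
      have := congrArg (Measure.map Prod.snd) hlaw
      rw [Measure.map_map measurable_snd (hU.prodMk hL), Measure.map_snd_prod] at this
      simpa [Function.comp_def] using this
    refine ⟨?_, h2⟩
    rw [indepFun_iff_map_prod_eq_prod_map_map hU.aemeasurable hL.aemeasurable, hlaw, h2]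
  have hDm : Measurable fun ω => N s ω - N t ω :=
    (hN.measurable s (ht.trans hs)).sub (hN.measurable t ht)
  have hL0 : Measurable fun ω => futureMarks t N l ω 0 := (measurable_pi_apply 0).comp hL
  have hWm : Measurable fun ω => futureIncrement t s hs (futureJumps η t N ω, futureMarks t N l ω) :=
    (measurable_futureIncrement t s hs).comp (hU.prodMk hL)
  have hDL : IndepFun (fun ω => N s ω - N t ω) (fun ω => futureMarks t N l ω 0) μ :=
    hUL.1.comp (φ := fun q : (Ici t → ℕ) × (ℕ → ℝ) => q.1 ⟨s, hs⟩) (ψ := fun q : ℕ → ℝ => q 0)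
      (by fun_prop) (by fun_prop)
  have hL0law : μ.map (fun ω => futureMarks t N l ω 0) = laplaceMeasure 1 := by
    have := congrArg (Measure.map fun q : ℕ → ℝ => q 0) hUL.2
    rw [Measure.map_map (measurable_pi_apply 0) hL] at this
    rw [(measurePreserving_eval_infinitePi (fun _ : ℕ => laplaceMeasure 1) 0).map_eq] at this
    exact this
  obtain ⟨hp0, hp1⟩ := hN.measureReal_increment hη ht hs
  have hmain := norm_charFun_sub_le_of_single_term (μ := μ) hDm hL0 hWm hDL hL0law
    integrable_abs_laplaceMeasure_one
    (fun ω h => by simp [futureIncrement, futureJumps, h])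
    (fun ω h => by
      have hcp := hN.isCountingPath ω
      -- The only jump between `t` and `s` is the first one after `t`.
      refine ⟨jumpTime η (fun s => N s ω) (N t ω + 0 + 1), ?_, ?_, ?_⟩
      · have h1 := (hcp.succ_le_iff hη (ht.trans hs) (N t ω)).1 (by omega)
        by_contra hlt
        have := (hcp.succ_le_iff hη ht (N t ω)).2 ⟨h1.1, (not_le.1 hlt).le⟩
        omega
      · exact ((hcp.succ_le_iff hη (ht.trans hs) (N t ω)).1 (by omega)).2
      · simp [futureIncrement, futureJumps, h]) θ
  rw [hp0, hp1] at hmain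
  have hfs : f s = f t * charFun (μ.map fun ω =>
      futureIncrement t s hs (futureJumps η t N ω, futureMarks t N l ω)) θ := by
    rw [hf s, hf t]
    simp_rw [laplacePath_eq_add_futureIncrement hN ht hs]
    have hZm := (measurable_laplacePath hη hN.isCountingPath hN.measurable hl.measurable ht).aemeasurable (μ := μ)
    have := (hZ.comp measurable_id (measurable_futureIncrement t s hs)).charFun_map_fun_add_eq_mul
      hZm hWm.aemeasurable
    exact congrFun this θ
  have hft : ‖f t‖ ≤ 1 := by
    rw [hf t]
    have := Measure.isProbabilityMeasure_map (μ := μ)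
      (measurable_laplacePath hη hN.isCountingPath hN.measurable hl.measurable ht).aemeasurable
    exact norm_charFun_le_one _
  constructor
  · refine le_trans ?_ hmain.1
    rw [hfs, show ∀ a b c : ℂ, a * b - a - a * c = a * (b - 1 - c) by intros; ring, norm_mul]
    exact mul_le_of_le_one_left (norm_nonneg _) hft
  · refine le_trans ?_ hmain.2
    rw [hfs, show ∀ a b : ℂ, a * b - a = a * (b - 1) by intros; ring, norm_mul]
    exact mul_le_of_le_one_left (norm_nonneg _) hft

/-- The Laplace process has at time `t` the Laplace distribution with scale `t`. -/
theorem map_laplacePath (hη : 0 < η)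
    (hN : IsPoissonProcess η (fun t => 2 / t) N μ) (hl : IsStdLaplaceSeq l μ)
    (hind : IndepFun (fun ω (t : Ici η) => N t ω) (fun ω n => l n ω) μ) {t : ℝ} (ht : η ≤ t) :
    μ.map (fun ω => laplacePath η (fun s => N s ω) (fun n => l n ω) t) = laplaceMeasure t := by
  have hpt := isProbabilityMeasure_laplaceMeasure (hη.trans_le ht)
  have hpm := Measure.isProbabilityMeasure_map (μ := μ)
      (measurable_laplacePath hη hN.isCountingPath hN.measurable hl.measurable ht).aemeasurable
  refine Measure.ext_of_charFun (funext fun θ => ?_)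
  obtain ⟨f, hf⟩ : ∃ f : ℝ → ℂ, ∀ t, f t = charFun
    (μ.map fun ω => laplacePath η (fun s => N s ω) (fun n => l n ω) t) θ := ⟨_, fun _ => rfl⟩
  have hexp := fun {r s : ℝ} (hr : η ≤ r) (hs : r ≤ s) =>
    charFun_laplacePath_expansion hη hN hl hind θ hf hr hs
  have hcont : ContinuousOn f (Ici η) := by
    intro r hr
    have hr0 : 0 < r := hη.trans_le hr
    rw [ContinuousWithinAt, tendsto_iff_norm_sub_tendsto_zero]
    -- The expansion compares an earlier time with a later one; `min` and `max` treat both sides of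
    -- `r` at once.
    have hB : Filter.Tendsto (fun s => 2 * (1 - (min r s / max r s) ^ 2))
        (nhdsWithin r (Ici η)) (nhds 0) := by
      have hc : ContinuousAt (fun s => 2 * (1 - (min r s / max r s) ^ 2)) r := by
        have : max r r ≠ 0 := by simpa using hr0.ne'
        fun_prop (disch := assumption)
      have := hc.continuousWithinAt.tendsto (x := r) (s := Ici η)
      simpa [hr0.ne'] using this
    refine tendsto_of_tendsto_of_tendsto_of_le_of_le' tendsto_const_nhds hB
      (Filter.Eventually.of_forall fun s => norm_nonneg _) ?_
    filter_upwards [self_mem_nhdsWithin] with s hs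
    rcases le_total r s with hrs | hsr
    · rw [min_eq_left hrs, max_eq_right hrs]
      exact (hexp hr hrs).2
    · rw [min_eq_right hsr, max_eq_left hsr, norm_sub_rev]
      exact (hexp hs hsr).2
  have hderiv : ∀ r, η ≤ r → HasDerivWithinAt f
      (f r * ((2 / r : ℝ) * (charFun (laplaceMeasure 1) (r * θ) - 1))) (Ici r) r := by
    intro r hr
    have hr0 : 0 < r := hη.trans_le hr
    set c : ℂ := charFun (laplaceMeasure 1) (r * θ) - 1
    set K : ℝ := ∫ z, |z| ∂(laplaceMeasure 1)
    have hd0 : HasDerivAt (fun s : ℝ => (r / s) ^ 2) (-(2 / r)) r := by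
      have := ((hasDerivAt_const r r).div (hasDerivAt_id r) hr0.ne').pow 2
      convert! this using 1
      simp only [id]
      field_simp
      norm_num
      exact hr0.ne'
    have hd1 : HasDerivAt (fun s : ℝ => 2 * Real.log (s / r) * (r / s) ^ 2) (2 / r) r := by
      have h1 : HasDerivAt (fun s : ℝ => 2 * Real.log (s / r)) (2 / r) r := by
        have := (((hasDerivAt_id r).div_const r).log (by simp [hr0.ne'])).const_mul 2
        convert! this using 1
        simp only [id]
        field_simp
      convert! h1.mul hd0 using 1
      simp [hr0.ne']
    -- The error is of second order: the probabilities of no jump and of one jump have derivatives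
    -- `-2/r` and `2/r` at `s = r`, which cancel, and the other term is a product of two factors
    -- vanishing there.
    have hdE : HasDerivAt (fun s : ℝ =>
        |θ| * (s - r) * (2 * Real.log (s / r) * (r / s) ^ 2 * K)
          + 2 * (1 - (r / s) ^ 2 - 2 * Real.log (s / r) * (r / s) ^ 2)) 0 r := by
      have h1 := (((hasDerivAt_id r).sub_const r).const_mul |θ|).mul (hd1.mul_const K)
      have h2 := ((((hasDerivAt_const r (1 : ℝ)).sub hd0).sub hd1).const_mul 2)
      convert! h1.add h2 using 1
      simp [hr0.ne']
    have hrem : HasDerivWithinAt (fun s => f s - f r - f r *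
        ((2 * Real.log (s / r) * (r / s) ^ 2 : ℝ) * c)) 0 (Ici r) r := by
      rw [hasDerivWithinAt_iff_isLittleO]
      have hE := hasDerivWithinAt_iff_isLittleO.1 (hdE.hasDerivWithinAt (s := Ici r))
      refine Asymptotics.IsBigO.trans_isLittleO ?_ hE
      refine Asymptotics.IsBigO.of_bound 1 ?_
      filter_upwards [self_mem_nhdsWithin] with s hs
      have := (hexp hr hs).1
      simp only [smul_zero, sub_zero, one_mul, div_self hr0.ne', Real.log_one, mul_zero, zero_mul,
        sub_self, one_pow, add_zero, Complex.ofReal_zero]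
      exact this.trans (le_abs_self _)
    have hlin : HasDerivWithinAt (fun s => f r + f r *
        ((2 * Real.log (s / r) * (r / s) ^ 2 : ℝ) * c)) (f r * ((2 / r : ℝ) * c)) (Ici r) r :=
      (((hd1.ofReal_comp.mul_const c).const_mul (f r)).const_add (f r)).hasDerivWithinAt
    convert! hrem.add hlin using 1
    · funext s
      simp
    · simp
  have hη' : f η = ((1 / (1 + (η * θ) ^ 2) : ℝ) : ℂ) := by
    rw [hf η, ← charFun_laplaceMeasure hη θ, ← laplaceMeasure_one_map_mul hη, ← (hl.law 0).map_eq,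
      Measure.map_map (by fun_prop) (hl.measurable 0)]
    congr 2
    funext ω
    simp [laplacePath, hN.init ω, jumpTime]
  -- The equation reads `f' = -2rθ² / (1 + r²θ²) * f`, so this product has right derivative zero.
  -- Continuity makes one-sided derivatives enough.
  have hF := constant_of_has_deriv_right_zero (a := η) (b := t)
    (f := fun r => f r * ((1 + (r * θ) ^ 2 : ℝ) : ℂ))
    ((hcont.mono fun r hr => hr.1).mul (by fun_prop)) (fun r hr => by
      have hr0 : 0 < r := hη.trans_le hr.1
      have hq : HasDerivAt (fun r : ℝ => (1 + (r * θ) ^ 2 : ℝ)) (2 * r * θ ^ 2) r := by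
        have := (((hasDerivAt_id r).mul_const θ).pow 2).const_add 1
        convert! this using 1
        simp only [id]
        norm_num
        ring
      have := (hderiv r hr.1).mul hq.ofReal_comp.hasDerivWithinAt
      convert! this using 1
      rw [charFun_laplaceMeasure one_pos, one_mul]
      have n1 : ((1 + (r * θ) ^ 2 : ℝ) : ℂ) ≠ 0 := by
        exact_mod_cast (by positivity : (1 + (r * θ) ^ 2 : ℝ) ≠ 0)
      have n2 : (r : ℂ) ≠ 0 := by exact_mod_cast hr0.ne'
      push_cast at n1 ⊢
      simp only [mul_pow] at n1 ⊢
      field_simp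
      ring) t ⟨ht, le_rfl⟩
  have n1 : ∀ r : ℝ, ((1 + (r * θ) ^ 2 : ℝ) : ℂ) ≠ 0 := fun r => by
    exact_mod_cast (by positivity : (1 + (r * θ) ^ 2 : ℝ) ≠ 0)
  rw [hη', ← Complex.ofReal_mul, one_div_mul_cancel (by positivity), Complex.ofReal_one] at hF
  rw [← hf t, charFun_laplaceMeasure (hη.trans_le ht), eq_div_of_mul_eq (n1 t) hF]
  push_cast
  rfl

end Marginal

/-! ### Halting probabilities on neighbouring databases -/

/-- The coordinates are shifted one after the other, each at the cost of the exponential of shift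
over scale. -/
theorem laplaceMeasure_prod_le_shift {t Δ δ : ℝ} (ht : 0 < t) (hΔ : 0 ≤ Δ) (hδ : 0 ≤ δ)
    {S S' : Set (ℝ × ℝ)} (hS : MeasurableSet S) (hS' : MeasurableSet S')
    (h : ∀ z s, (z, s) ∈ S → (z + Δ, s + δ) ∈ S') :
    ((laplaceMeasure t).prod (laplaceMeasure 1)) S
      ≤ ENNReal.ofReal (Real.exp (Δ / t + δ))
        * ((laplaceMeasure t).prod (laplaceMeasure 1)) S' := by
  have := isProbabilityMeasure_laplaceMeasure ht
  have hsec : ∀ z : ℝ, laplaceMeasure 1 (Prod.mk (z - Δ) ⁻¹' S)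
      ≤ ENNReal.ofReal (Real.exp δ) * laplaceMeasure 1 (Prod.mk z ⁻¹' S') := by
    intro z
    have hm : MeasurableSet (Prod.mk (z - Δ) ⁻¹' S) := measurable_prodMk_left hS
    have hm' : MeasurableSet (Prod.mk z ⁻¹' S') := measurable_prodMk_left hS'
    have hle := lintegral_laplaceMeasure_le_shift one_pos hδ
      ((measurable_const (a := (1 : ℝ≥0∞))).indicator hm)
    rw [lintegral_indicator_const hm, one_mul, div_one] at hle
    refine hle.trans ?_
    gcongr
    rw [← one_mul (laplaceMeasure 1 (Prod.mk z ⁻¹' S')), ← lintegral_indicator_const hm']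
    refine lintegral_mono fun s => ?_
    by_cases hs : s - δ ∈ Prod.mk (z - Δ) ⁻¹' S
    · have hs' : s ∈ Prod.mk z ⁻¹' S' := by simpa using h _ _ hs
      rw [indicator_of_mem hs, indicator_of_mem hs']
    · rw [indicator_of_notMem hs]
      exact zero_le
  rw [Measure.prod_apply hS, Measure.prod_apply hS']
  calc ∫⁻ z, laplaceMeasure 1 (Prod.mk z ⁻¹' S) ∂(laplaceMeasure t)
      ≤ ENNReal.ofReal (Real.exp (Δ / t))
        * ∫⁻ z, laplaceMeasure 1 (Prod.mk (z - Δ) ⁻¹' S) ∂(laplaceMeasure t) :=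
        lintegral_laplaceMeasure_le_shift ht hΔ (measurable_measure_prodMk_left hS)
    _ ≤ ENNReal.ofReal (Real.exp (Δ / t)) * ∫⁻ z, ENNReal.ofReal (Real.exp δ)
          * laplaceMeasure 1 (Prod.mk z ⁻¹' S') ∂(laplaceMeasure t) := by
        gcongr with z
        exact hsec z
    _ = _ := by
        rw [lintegral_const_mul' _ _ ENNReal.ofReal_ne_top, ← mul_assoc,
          ← ENNReal.ofReal_mul (Real.exp_pos _).le, ← Real.exp_add]

/-- The event that the noisy comparisons `c k + b k * ξ k` against `τ + Z (T k)` fail for `k < m`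
and succeed for `k = m`. -/
def haltingEvent {Ω : Type*} (η τ : ℝ) (N : ℝ → Ω → ℕ) (l ξ : ℕ → Ω → ℝ) (T b c : ℕ → ℝ) (m : ℕ) :
    Set Ω :=
  {ω | (∀ k < m, ¬ τ + laplacePath η (fun s => N s ω) (fun n => l n ω) (T k) ≤ c k + b k * ξ k ω) ∧
    τ + laplacePath η (fun s => N s ω) (fun n => l n ω) (T m) ≤ c m + b m * ξ m ω}

/-- The values of the noise in the rounds up to `m` other than the Laplace process at time `t` and
the query noise in round `m`. -/
abbrev RestNoise (t : ℝ) (m : ℕ) : Type :=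
  (((Ici t → ℕ) × (ℕ → ℝ)) × (ℕ → ℝ)) × (Finset.range m → ℝ)

/-- Joint law of the Laplace process at time `t`, the query noise in round `m`, and the remaining
noise in the rounds up to `m`. -/
theorem IsThresholdNoise.map_eq_prod {Ω : Type*} [MeasurableSpace Ω] {μ : Measure Ω}
    [IsProbabilityMeasure μ] {η : ℝ} (hη : 0 < η) {N : ℝ → Ω → ℕ} {l ξ : ℕ → Ω → ℝ}
    (h : IsThresholdNoise η N l ξ μ) {t : ℝ} (ht : η ≤ t) (m : ℕ) :
    ∃ ν : Measure (RestNoise t m),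
      IsProbabilityMeasure ν ∧
      Measurable (fun ω => ((laplacePath η (fun s => N s ω) (fun n => l n ω) t, ξ m ω),
        ((futureJumps η t N ω, futureMarks t N l ω), fun k : Finset.range m => ξ k ω))) ∧
      μ.map (fun ω => ((laplacePath η (fun s => N s ω) (fun n => l n ω) t, ξ m ω),
        ((futureJumps η t N ω, futureMarks t N l ω), fun k : Finset.range m => ξ k ω)))
        = ((laplaceMeasure t).prod (laplaceMeasure 1)).prod ν := by
  have hN := h.poisson
  have hcp := hN.isCountingPath
  have hl := h.marks
  obtain ⟨hU, hL, hind, -⟩ := laplacePath_indepFun_future hη hN hl h.indep_marks ht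
  have hZ := measurable_laplacePath hη hcp hN.measurable hl.measurable ht
  have hx : Measurable fun ω (k : Finset.range m) => ξ k ω :=
    measurable_pi_lambda _ fun k => h.query.measurable k
  have hξ : IndepFun (ξ m) (fun ω (k : Finset.range m) => ξ k ω) μ :=
    ((iIndepFun_nat_indepFun_shift h.query.indep h.query.measurable m).comp measurable_id
      (ψ := fun q : ℕ → ℝ => q 0) (by fun_prop)).symm
  let Φ : Ω → (Ici η → ℕ) × (ℕ → ℝ) := fun ω => ((fun r => N r ω), fun n => l n ω)
  have hN' : ∀ s, η ≤ s → Measurable[Prod.instMeasurableSpace.comap Φ] (N s) := fun s hs =>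
    ((measurable_pi_apply (⟨s, hs⟩ : Ici η)).comp measurable_fst).comp (comap_measurable Φ)
  have hl' : ∀ n, Measurable[Prod.instMeasurableSpace.comap Φ] (l n) := fun n =>
    ((measurable_pi_apply n).comp measurable_snd).comp (comap_measurable Φ)
  have hξ' : ∀ n, Measurable[MeasurableSpace.pi.comap fun ω n => ξ n ω] (ξ n) := fun n =>
    (measurable_pi_apply n).comp (comap_measurable fun ω n => ξ n ω)
  have hbig : IndepFun
      (fun ω => (laplacePath η (fun s => N s ω) (fun n => l n ω) t,
        (futureJumps η t N ω, futureMarks t N l ω)))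
      (fun ω => (ξ m ω, fun k : Finset.range m => ξ k ω)) μ := by
    refine h.indep_query.of_measurable_comap ?_ ?_
    · refine Measurable.prodMk ?_ (Measurable.prodMk ?_ ?_)
      · exact @measurable_laplacePath _ (Prod.instMeasurableSpace.comap Φ) _ hη _ hcp hN' _ hl' _ ht
      · exact @measurable_futureJumps _ (Prod.instMeasurableSpace.comap Φ) _ _ _ hη ht hcp
          fun s hs => (hN' s (ht.trans hs)).sub (hN' t ht)
      · exact @measurable_futureMarks _ (Prod.instMeasurableSpace.comap Φ) _ _ _ (hN' t ht) hl'
    · exact (hξ' m).prodMk (@measurable_pi_lambda _ _ _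
        (MeasurableSpace.pi.comap fun ω n => ξ n ω) _ _ fun k => hξ' k)
  -- Regroups the noise so that the two variables to be shifted, `Z_t` and `ξ m`, are separated from
  -- everything that stays frozen.
  have hfour := indepFun_prodMk_prodMk_of_indepFun hZ (hU.prodMk hL) (h.query.measurable m) hx
    hind hξ hbig
  have hpair : IndepFun (fun ω => laplacePath η (fun s => N s ω) (fun n => l n ω) t) (ξ m) μ :=
    hbig.comp measurable_fst measurable_fst
  have hm1 := hZ.prodMk (h.query.measurable m)
  have hm2 := (hU.prodMk hL).prodMk hx
  refine ⟨_, Measure.isProbabilityMeasure_map (μ := μ) hm2.aemeasurable, hm1.prodMk hm2, ?_⟩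
  rw [(indepFun_iff_map_prod_eq_prod_map_map hm1.aemeasurable hm2.aemeasurable).1 hfour,
    (indepFun_iff_map_prod_eq_prod_map_map hZ.aemeasurable
      (h.query.measurable m).aemeasurable).1 hpair, map_laplacePath hη hN hl h.indep_marks ht,
    (h.query.law m).map_eq]

/-- For `k < m`, `T m ≤ T k`, so raising `Z` at time `T m` by `Δ` with frozen increments raises
every earlier threshold by `Δ`, and failures stay failures since `c' k ≤ c k + Δ`. Raising `ξ m` by
`2Δ / b m` adds `2Δ` in round `m`: `Δ` for the raised threshold and `Δ` for `c' m ≥ c m - Δ`. -/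
theorem IsThresholdNoise.measure_haltingEvent_le {Ω : Type*} [MeasurableSpace Ω] {μ : Measure Ω}
    [IsProbabilityMeasure μ] {η : ℝ} (hη : 0 < η) {N : ℝ → Ω → ℕ} {l ξ : ℕ → Ω → ℝ}
    (h : IsThresholdNoise η N l ξ μ) {τ Δ : ℝ} {T b c c' : ℕ → ℝ} {m : ℕ} (hT : η ≤ T m)
    (hTm : ∀ k < m, T m ≤ T k) (hb : 0 < b m) (hΔ : 0 ≤ Δ) (hc : ∀ k ≤ m, |c k - c' k| ≤ Δ) :
    μ (haltingEvent η τ N l ξ T b c m)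
      ≤ ENNReal.ofReal (Real.exp (Δ / T m + 2 * Δ / b m))
        * μ (haltingEvent η τ N l ξ T b c' m) := by
  obtain ⟨ν, hν, hmeas, hlaw⟩ := h.map_eq_prod hη hT m
  have hpt := isProbabilityMeasure_laplaceMeasure (hη.trans_le hT)
  let B : (ℕ → ℝ) → Set ((ℝ × ℝ) × RestNoise (T m) m) := fun c =>
    {q | (∀ k : Finset.range m, ¬ τ + (q.1.1 + futureIncrement (T m) (T k)
      (hTm k (Finset.mem_range.1 k.2)) q.2.1) ≤ c k + b k * q.2.2 k) ∧
      τ + q.1.1 ≤ c m + b m * q.1.2}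
  have hB : ∀ c, MeasurableSet (B c) := by
    intro c
    have h2 : MeasurableSet {q : (ℝ × ℝ) × RestNoise (T m) m | τ + q.1.1 ≤ c m + b m * q.1.2} :=
      measurableSet_le (by fun_prop) (by fun_prop)
    have h1 : ∀ k : Finset.range m, MeasurableSet {q : (ℝ × ℝ) × RestNoise (T m) m |
        ¬ τ + (q.1.1 + futureIncrement (T m) (T k) (hTm k (Finset.mem_range.1 k.2)) q.2.1)
          ≤ c k + b k * q.2.2 k} := fun k => by
      have hf := measurable_futureIncrement (T m) (T k) (hTm k (Finset.mem_range.1 k.2))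
      have h3 : MeasurableSet {q : (ℝ × ℝ) × RestNoise (T m) m |
          τ + (q.1.1 + futureIncrement (T m) (T k) (hTm k (Finset.mem_range.1 k.2)) q.2.1)
            ≤ c k + b k * q.2.2 k} := measurableSet_le (by fun_prop) (by fun_prop)
      exact h3.compl
    have hBc : B c = (⋂ k : Finset.range m, {q : (ℝ × ℝ) × RestNoise (T m) m |
        ¬ τ + (q.1.1 + futureIncrement (T m) (T k) (hTm k (Finset.mem_range.1 k.2)) q.2.1)
          ≤ c k + b k * q.2.2 k})
        ∩ {q : (ℝ × ℝ) × RestNoise (T m) m | τ + q.1.1 ≤ c m + b m * q.1.2} := by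
      ext q
      simp only [B, mem_inter_iff, mem_iInter, mem_ofPred_eq]
    rw [hBc]
    exact (MeasurableSet.iInter h1).inter h2
  have hev : ∀ c, μ (haltingEvent η τ N l ξ T b c m)
      = (((laplaceMeasure (T m)).prod (laplaceMeasure 1)).prod ν) (B c) := by
    intro c
    rw [← hlaw, Measure.map_apply hmeas (hB c)]
    congr 1
    ext ω
    simp only [haltingEvent, B, mem_preimage, mem_ofPred_eq]
    refine and_congr_left fun _ => ?_
    constructor
    · intro hω k
      rw [← laplacePath_eq_add_futureIncrement h.poisson hT]
      exact hω k (Finset.mem_range.1 k.2)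
    · intro hω k hk
      rw [laplacePath_eq_add_futureIncrement h.poisson hT (hTm k hk)]
      exact hω ⟨k, Finset.mem_range.2 hk⟩
  rw [hev, hev, Measure.prod_apply_symm (hB c), Measure.prod_apply_symm (hB c'),
    ← lintegral_const_mul' _ _ ENNReal.ofReal_ne_top]
  refine lintegral_mono fun y => ?_
  refine laplaceMeasure_prod_le_shift (hη.trans_le hT) hΔ (by positivity)
    (measurable_prodMk_right (hB c)) (measurable_prodMk_right (hB c')) ?_
  rintro z s ⟨h1, h2⟩
  refine ⟨fun k => ?_, ?_⟩
  · have := h1 k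
    have hk := abs_le.1 (hc k (Finset.mem_range.1 k.2).le)
    simp only [not_le] at this ⊢
    linarith [hk.1]
  · have hk := abs_le.1 (hc m le_rfl)
    have hbm : b m * (s + 2 * Δ / b m) = b m * s + 2 * Δ := by
      field_simp
    simp only at h2 ⊢
    rw [hbm]
    linarith [hk.2]

/-! ### Transcripts -/

theorem haltingRound_eq_of_first {b : ℕ → Bool} {m : ℕ} (h : ∀ k < m, b k = false)
    (hm : b m = true) : haltingRound b = ((m + 1 : ℕ) : ℕ∞) := by
  refine le_antisymm (sInf_le ⟨m, by push_cast; rfl, hm⟩) (le_sInf ?_)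
  rintro _ ⟨k, rfl, hk⟩
  have : m ≤ k := by
    by_contra hlt
    simp [h k (not_le.1 hlt)] at hk
  exact_mod_cast Nat.succ_le_succ this

theorem haltingRound_eq_top {b : ℕ → Bool} (h : ∀ k, b k = false) : haltingRound b = ⊤ := by
  rw [haltingRound, sInf_eq_top]
  rintro _ ⟨k, rfl, hk⟩
  simp [h k] at hk

theorem haltingRound_cases (b : ℕ → Bool) :
    (haltingRound b = ⊤ ∧ ∀ k, b k = false) ∨
    ∃ m : ℕ, haltingRound b = ((m + 1 : ℕ) : ℕ∞) ∧ (∀ k < m, b k = false) ∧ b m = true := by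
  by_cases h : ∃ k, b k = true
  · classical
    refine Or.inr ⟨Nat.find h, ?_, fun k hk => ?_, Nat.find_spec h⟩
    · exact haltingRound_eq_of_first (fun k hk => by simpa using Nat.find_min h hk)
        (Nat.find_spec h)
    · simpa using Nat.find_min h hk
  · have h' : ∀ k, b k = false := by simpa using h
    exact Or.inl ⟨haltingRound_eq_top h', h'⟩

theorem haltingRound_eq_succ_iff {b : ℕ → Bool} {m : ℕ} :
    haltingRound b = ((m + 1 : ℕ) : ℕ∞) ↔ (∀ k < m, b k = false) ∧ b m = true := by
  refine ⟨fun h => ?_, fun h => haltingRound_eq_of_first h.1 h.2⟩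
  rcases haltingRound_cases b with ⟨h', -⟩ | ⟨k, h', hk⟩
  · rw [h'] at h
    exact absurd h.symm (ENat.natCast_ne_top _)
  · rw [h', Nat.cast_inj, Nat.succ_inj] at h
    rwa [← h]

theorem haltingRound_ne_zero (b : ℕ → Bool) : haltingRound b ≠ 0 := by
  rcases haltingRound_cases b with ⟨h, -⟩ | ⟨k, h, -⟩ <;> rw [h]
  · simp
  · exact_mod_cast Nat.succ_ne_zero k

theorem measurable_haltingRound : Measurable haltingRound := by
  have hs : ∀ m : ℕ, MeasurableSet {b : ℕ → Bool | (∀ k < m, b k = false) ∧ b m = true} := by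
    intro m
    have h1 : ∀ (k : ℕ) (v : Bool), MeasurableSet {b : ℕ → Bool | b k = v} := fun k v =>
      measurableSet_eq_fun (measurable_pi_apply k) measurable_const
    have : {b : ℕ → Bool | (∀ k < m, b k = false) ∧ b m = true}
        = (⋂ k ∈ Finset.range m, {b : ℕ → Bool | b k = false}) ∩ {b | b m = true} := by
      ext b
      simp
    rw [this]
    exact (Finset.measurableSet_biInter _ fun k _ => h1 k false).inter (h1 m true)
  refine measurable_to_countable' fun n => ?_
  have hfin : ∀ m : ℕ, MeasurableSet (haltingRound ⁻¹' {((m + 1 : ℕ) : ℕ∞)}) := fun m => by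
    convert hs m using 1
    ext b
    exact haltingRound_eq_succ_iff
  induction n using ENat.recTopCoe with
  | top =>
    have : haltingRound ⁻¹' {⊤} = (⋃ m : ℕ, haltingRound ⁻¹' {((m + 1 : ℕ) : ℕ∞)})ᶜ := by
      ext b
      simp only [mem_preimage, mem_singleton_iff, mem_compl_iff, mem_iUnion, not_exists]
      constructor
      · intro h m hm
        rw [h] at hm
        exact ENat.natCast_ne_top _ hm.symm
      · intro h
        rcases haltingRound_cases b with ⟨h', -⟩ | ⟨k, h', -⟩
        · exact h'
        · exact absurd h' (h k)
    rw [this]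
    exact (MeasurableSet.iUnion hfin).compl
  | coe n =>
    cases n with
    | zero =>
      have : haltingRound ⁻¹' {((0 : ℕ) : ℕ∞)} = ∅ := by
        ext b
        simpa using haltingRound_ne_zero b
      rw [this]
      exact MeasurableSet.empty
    | succ n => exact hfin n

theorem measurable_sigma_mk {ι : Type*} {β : ι → Type*} [∀ i, MeasurableSpace (β i)] (i : ι) :
    Measurable (Sigma.mk i : β i → Sigma β) :=
  Measurable.of_le_map (iInf_le _ i)

theorem measurable_of_sigma {ι γ : Type*} {β : ι → Type*} [∀ i, MeasurableSpace (β i)]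
    [MeasurableSpace γ] {f : Sigma β → γ} (h : ∀ i, Measurable fun x => f ⟨i, x⟩) :
    Measurable f :=
  Measurable.of_comap_le <| le_iInf fun i => MeasurableSpace.comap_le_iff_le_map.2 (h i)

section Transcripts

variable {Y : Type*} [MeasurableSpace Y]

theorem measurable_firstTerms {S : Type*} [MeasurableSpace S] (n : ℕ) :
    Measurable fun a : ℕ → S => firstTerms a n :=
  measurable_pi_lambda _ fun i => measurable_pi_apply (i : ℕ)

theorem measurable_haltedTranscript :
    Measurable fun q : (ℕ → Y) × (ℕ → Bool) => haltedTranscript q.1 q.2 := by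
  obtain ⟨F, hF⟩ : ∃ F : ℕ∞ × ((ℕ → Y) × (ℕ → Bool)) → Transcript Y, F = fun q =>
    if q.1 = ⊤ then Sum.inr fun k => (q.2.1 k, q.2.2 k)
    else Sum.inl ⟨q.1.toNat, firstTerms (fun k => (q.2.1 k, q.2.2 k)) q.1.toNat⟩ := ⟨_, rfl⟩
  have hF' : Measurable F := by
    refine measurable_from_prod_countable_right fun n => ?_
    have hpair : Measurable fun (q : (ℕ → Y) × (ℕ → Bool)) (k : ℕ) => (q.1 k, q.2 k) := by fun_prop
    by_cases hn : n = ⊤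
    · simp only [hF, hn, if_true]
      exact measurable_inr.comp hpair
    · simp only [hF, hn, if_false]
      exact measurable_inl.comp ((measurable_sigma_mk _).comp ((measurable_firstTerms _).comp hpair))
  have h2 : (fun q : (ℕ → Y) × (ℕ → Bool) => haltedTranscript q.1 q.2)
      = fun q => F (haltingRound q.2, q) := by
    rw [hF]
    rfl
  rw [h2]
  exact hF'.comp ((measurable_haltingRound.comp measurable_snd).prodMk measurable_id)

/-- The transcripts of `n` rounds. -/
def transcriptsOfLength (Y : Type*) (n : ℕ) : Set (Transcript Y) :=
  Sum.inl '' (Sigma.fst ⁻¹' {n})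

theorem measurableSet_transcriptsOfLength (n : ℕ) : MeasurableSet (transcriptsOfLength Y n) :=
  MeasurableSet.inl_image (measurable_of_sigma (fun _ => measurable_const)
    (measurableSet_singleton n))

/-- The transcript of `m + 1` rounds with the given iterates, halting in the last round. -/
def haltAfter (m : ℕ) (β : Fin (m + 1) → Y) : Transcript Y :=
  Sum.inl ⟨m + 1, fun i => (β i, decide ((i : ℕ) = m))⟩

theorem measurable_haltAfter (m : ℕ) : Measurable (haltAfter (Y := Y) m) :=
  measurable_inl.comp ((measurable_sigma_mk (m + 1)).comp (by fun_prop))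

/-- The first `n` iterates of a transcript, completed by `y₀` if the transcript is too short. -/
def transcriptIterates (y₀ : Y) (n : ℕ) : Transcript Y → Fin n → Y :=
  Sum.elim (fun w i => if h : (i : ℕ) < w.1 then (w.2 ⟨i, h⟩).1 else y₀) (fun f i => (f i).1)

theorem measurable_transcriptIterates (y₀ : Y) (n : ℕ) :
    Measurable (transcriptIterates y₀ n) := by
  refine Measurable.sumElim (measurable_of_sigma fun k => measurable_pi_lambda _ fun i => ?_)
    (by fun_prop)
  by_cases h : (i : ℕ) < k
  · simp only [h, dif_pos]
    exact (measurable_fst.comp (measurable_pi_apply (⟨i, h⟩ : Fin k)) :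
      Measurable fun w : Fin k → Y × Bool => (w ⟨i, h⟩).1)
  · simp only [h, dif_neg, not_false_eq_true]
    fun_prop

theorem transcriptIterates_haltAfter {Y : Type*} (y₀ : Y) (m : ℕ) (β : Fin (m + 1) → Y) :
    transcriptIterates y₀ (m + 1) (haltAfter m β) = β := by
  funext i
  exact dif_pos i.2

theorem haltedTranscript_eq_haltAfter {Y : Type*} {a : ℕ → Y} {b : ℕ → Bool} {m : ℕ}
    (h : haltingRound b = ((m + 1 : ℕ) : ℕ∞)) :
    haltedTranscript a b = haltAfter m (firstTerms a (m + 1)) := by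
  have hb := haltingRound_eq_succ_iff.1 h
  rw [haltedTranscript, h, if_neg (ENat.natCast_ne_top _), ENat.toNat_natCast, haltAfter]
  congr 2
  funext i
  refine Prod.ext rfl ?_
  simp only [firstTerms]
  rcases Nat.lt_or_ge (i : ℕ) m with hi | hi
  · rw [hb.1 i hi, decide_eq_false hi.ne]
  · have : (i : ℕ) = m := by omega
    rw [decide_eq_true this, this, hb.2]

theorem haltedTranscript_mem_transcriptsOfLength {Y : Type*} {a : ℕ → Y} {b : ℕ → Bool} {m : ℕ} :
    haltedTranscript a b ∈ transcriptsOfLength Y (m + 1)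
      ↔ haltingRound b = ((m + 1 : ℕ) : ℕ∞) := by
  constructor
  · rintro ⟨w, hw, hwe⟩
    rw [haltedTranscript] at hwe
    split_ifs at hwe with h
    have h1 := Sum.inl.inj hwe
    rw [h1] at hw
    rw [← ENat.natCast_toNat h]
    exact congrArg _ hw
  · intro h
    rw [haltedTranscript_eq_haltAfter h]
    exact ⟨_, rfl, rfl⟩

/-- Extension of a finite sequence of iterates to an infinite one. -/
def extendIterates (m : ℕ) (β : Fin (m + 1) → Y) (k : ℕ) : Y :=
  β ⟨min k m, Nat.lt_succ_of_le (min_le_right k m)⟩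

theorem measurable_extendIterates (m : ℕ) : Measurable (extendIterates (Y := Y) m) :=
  measurable_pi_lambda _ fun _ => measurable_pi_apply _

theorem extendIterates_firstTerms {Y : Type*} (a : ℕ → Y) {m k : ℕ} (hk : k ≤ m) :
    extendIterates m (firstTerms a (m + 1)) k = a k := by
  simp [extendIterates, firstTerms, hk]

/-- The law of a transcript, restricted to the runs halting after `m + 1` rounds, when the iterates
`A` are independent of the noise `Θ` that determines the bits: the law of the first `m + 1`
iterates, reweighted by the probability of halting given the iterates. -/
theorem restrict_map_haltedTranscript {Ω S : Type*} [MeasurableSpace Ω] [MeasurableSpace S]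
    {μ : Measure Ω} [IsProbabilityMeasure μ] {A : Ω → ℕ → Y} {Θ : Ω → S} (hA : Measurable A)
    (hΘ : Measurable Θ) (hind : IndepFun A Θ μ) {B : (ℕ → Y) → S → ℕ → Bool}
    (hB : Measurable fun q : (ℕ → Y) × S => B q.1 q.2)
    (hdep : ∀ a a' θ k, (∀ i ≤ k, a i = a' i) → B a θ k = B a' θ k) (m : ℕ) :
    Measurable (fun β : Fin (m + 1) → Y =>
      μ.map Θ {θ | haltingRound (B (extendIterates m β) θ) = ((m + 1 : ℕ) : ℕ∞)}) ∧
    (μ.map fun ω => haltedTranscript (A ω) (B (A ω) (Θ ω))).restrict (transcriptsOfLength Y (m + 1))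
      = ((μ.map fun ω => firstTerms (A ω) (m + 1)).withDensity fun β =>
          μ.map Θ {θ | haltingRound (B (extendIterates m β) θ) = ((m + 1 : ℕ) : ℕ∞)}).map
            (haltAfter m) := by
  have pΘ := Measure.isProbabilityMeasure_map (μ := μ) hΘ.aemeasurable
  have hH : MeasurableSet {q : (ℕ → Y) × S | haltingRound (B q.1 q.2) = ((m + 1 : ℕ) : ℕ∞)} :=
    (measurable_haltingRound.comp hB) (measurableSet_singleton _)
  have hp : Measurable fun a : ℕ → Y =>
      μ.map Θ {θ | haltingRound (B a θ) = ((m + 1 : ℕ) : ℕ∞)} :=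
    measurable_measure_prodMk_left hH
  have hpe : Measurable fun β : Fin (m + 1) → Y =>
      μ.map Θ {θ | haltingRound (B (extendIterates m β) θ) = ((m + 1 : ℕ) : ℕ∞)} :=
    hp.comp (measurable_extendIterates m)
  have hft : Measurable fun ω => firstTerms (A ω) (m + 1) := (measurable_firstTerms _).comp hA
  have hAΘ : Measurable fun ω => (A ω, Θ ω) := hA.prodMk hΘ
  have hT : Measurable fun ω => haltedTranscript (A ω) (B (A ω) (Θ ω)) :=
    measurable_haltedTranscript.comp (hA.prodMk (hB.comp hAΘ))
  -- Halting in round `m + 1` involves only the bits with index at most `m`, which read only the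
  -- first `m + 1` iterates; the choice of extension is immaterial.
  have hext : ∀ a : ℕ → Y,
      {θ | haltingRound (B (extendIterates m (firstTerms a (m + 1))) θ) = ((m + 1 : ℕ) : ℕ∞)}
        = {θ | haltingRound (B a θ) = ((m + 1 : ℕ) : ℕ∞)} := by
    intro a
    ext θ
    simp only [mem_ofPred_eq, haltingRound_eq_succ_iff]
    have h : ∀ k ≤ m, B (extendIterates m (firstTerms a (m + 1))) θ k = B a θ k := fun k hk =>
      hdep _ _ θ k fun i hi => extendIterates_firstTerms a (hi.trans hk)
    rw [h m le_rfl]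
    refine and_congr_left fun _ => forall₂_congr fun k hk => ?_
    rw [h k hk.le]
  refine ⟨hpe, ?_⟩
  ext s hs
  have hG : MeasurableSet {q : (ℕ → Y) × S | haltAfter m (firstTerms q.1 (m + 1)) ∈ s ∧
      haltingRound (B q.1 q.2) = ((m + 1 : ℕ) : ℕ∞)} :=
    MeasurableSet.inter (((measurable_haltAfter m).comp
      ((measurable_firstTerms (m + 1)).comp measurable_fst)) hs) hH
  rw [Measure.restrict_apply hs, Measure.map_apply hT (hs.inter (measurableSet_transcriptsOfLength _)),
    Measure.map_apply (measurable_haltAfter m) hs,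
    withDensity_apply _ ((measurable_haltAfter m) hs),
    ← lintegral_indicator ((measurable_haltAfter m) hs),
    lintegral_map (hpe.indicator ((measurable_haltAfter m) hs)) hft]
  calc μ ((fun ω => haltedTranscript (A ω) (B (A ω) (Θ ω))) ⁻¹'
        (s ∩ transcriptsOfLength Y (m + 1)))
      = (μ.map fun ω => (A ω, Θ ω)) {q : (ℕ → Y) × S | haltAfter m (firstTerms q.1 (m + 1)) ∈ s ∧
          haltingRound (B q.1 q.2) = ((m + 1 : ℕ) : ℕ∞)} := by
        rw [Measure.map_apply hAΘ hG]
        congr 1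
        ext ω
        simp only [mem_preimage, mem_inter_iff, haltedTranscript_mem_transcriptsOfLength,
          mem_ofPred_eq]
        refine and_congr_left fun h => ?_
        rw [haltedTranscript_eq_haltAfter h]
    _ = ∫⁻ a, (haltAfter m ⁻¹' s).indicator (fun β => μ.map Θ {θ |
          haltingRound (B (extendIterates m β) θ) = ((m + 1 : ℕ) : ℕ∞)}) (firstTerms a (m + 1))
          ∂(μ.map A) := by
        -- By independence the noise is integrated out first, with the iterates fixed; this produces
        -- the weight.
        rw [(indepFun_iff_map_prod_eq_prod_map_map hA.aemeasurable hΘ.aemeasurable).1 hind,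
          Measure.prod_apply hG]
        refine lintegral_congr fun a => ?_
        by_cases ha : firstTerms a (m + 1) ∈ haltAfter m ⁻¹' s
        · rw [indicator_of_mem ha, hext]
          congr 1
          ext θ
          simp only [mem_preimage, mem_ofPred_eq]
          exact and_iff_right ha
        · rw [indicator_of_notMem ha]
          convert measure_empty (μ := μ.map Θ)
          ext θ
          simp only [mem_preimage, mem_ofPred_eq, mem_empty_iff_false, iff_false, not_and]
          exact fun h => absurd h ha
    _ = _ := by
        exact lintegral_map ((hpe.indicator ((measurable_haltAfter m) hs)).comp
          (measurable_firstTerms (m + 1))) hA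

end Transcripts

/-! ### Privacy of `ReducedAboveThreshold` -/

section Mechanism

variable {Y : Type*} [MeasurableSpace Y] {Δ εmax τ : ℝ} {E : (k : ℕ) → (Fin k → Y) → ℝ}

theorem IsPrivacyFunctions.div_le_div (hE : IsPrivacyFunctions εmax E) (hΔ : 0 < Δ) {k : ℕ}
    (β : Fin k → Y) : 2 * Δ / εmax ≤ 2 * Δ / E k β :=
  div_le_div_of_nonneg_left (by positivity) (hE.pos k β) (hE.le_max k β)

theorem IsPrivacyFunctions.monotone_firstTerms (hE : IsPrivacyFunctions εmax E) (a : ℕ → Y) :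
    Monotone fun k => E k (firstTerms a k) :=
  monotone_nat_of_le_succ fun k => hE.mono k (firstTerms a (k + 1))

/-- The bound `E k ≤ εmax` keeps the reading time in the range where the process is jointly
measurable. -/
theorem measurable_reducedAboveThresholdBits {Ω : Type*} [MeasurableSpace Ω]
    (hΔ : 0 < Δ) (hεmax : 0 < εmax) (hE : IsPrivacyFunctions εmax E) {v : Y → ℝ} (hv : Measurable v)
    {N : ℝ → Ω → ℕ} (hN : ∀ ω, IsCountingPath (2 * Δ / εmax) fun s => N s ω)
    (hm : ∀ s, 2 * Δ / εmax ≤ s → Measurable (N s)) {l ξ : ℕ → Ω → ℝ}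
    (hl : ∀ n, Measurable (l n)) (hξ : ∀ n, Measurable (ξ n)) :
    Measurable fun q : (ℕ → Y) × Ω => reducedAboveThresholdBits Δ εmax τ v E q.1
      (fun s => N s q.2) (fun n => l n q.2) (fun n => ξ n q.2) := by
  obtain ⟨G, hG⟩ : ∃ G : Ici (2 * Δ / εmax) × Ω → ℝ, G = fun q =>
    laplacePath (2 * Δ / εmax) (fun s => N s q.2) (fun n => l n q.2) q.1 := ⟨_, rfl⟩
  have hGm : Measurable G := by
    rw [hG]
    exact measurable_uncurry_laplacePath (by positivity) hN hm hl
  refine measurable_pi_lambda _ fun k => measurable_to_bool ?_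
  have hε : Measurable fun q : (ℕ → Y) × Ω => E k (firstTerms q.1 k) :=
    (hE.measurable k).comp ((measurable_firstTerms k).comp measurable_fst)
  have hT : Measurable fun q : (ℕ → Y) × Ω =>
      ((⟨2 * Δ / E k (firstTerms q.1 k), hE.div_le_div hΔ _⟩ : Ici (2 * Δ / εmax)), q.2) :=
    ((measurable_const.div hε).subtype_mk).prodMk measurable_snd
  have hZ := hGm.comp hT
  have hvm : Measurable fun q : (ℕ → Y) × Ω => v (q.1 k) :=
    hv.comp ((measurable_pi_apply k).comp measurable_fst)
  have hξm : Measurable fun q : (ℕ → Y) × Ω => ξ k q.2 := (hξ k).comp measurable_snd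
  have hset : MeasurableSet {q : (ℕ → Y) × Ω |
      τ + G (⟨2 * Δ / E k (firstTerms q.1 k), hE.div_le_div hΔ _⟩, q.2)
        ≤ v (q.1 k) + 4 * Δ / E k (firstTerms q.1 k) * ξ k q.2} :=
    measurableSet_le (measurable_const.add hZ) (hvm.add ((measurable_const.div hε).mul hξm))
  convert hset using 1
  ext q
  simp only [mem_preimage, mem_singleton_iff, mem_ofPred_eq, reducedAboveThresholdBits, ratBit, hG,
    decide_eq_true_eq]

theorem reducedAboveThresholdBits_congr {Y : Type*} {E : (k : ℕ) → (Fin k → Y) → ℝ} {v : Y → ℝ} {a a' : ℕ → Y} (p : ℝ → ℕ) (l ξ : ℕ → ℝ) {k : ℕ}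
    (h : ∀ i ≤ k, a i = a' i) :
    reducedAboveThresholdBits Δ εmax τ v E a p l ξ k
      = reducedAboveThresholdBits Δ εmax τ v E a' p l ξ k := by
  have h1 : firstTerms a k = firstTerms a' k := funext fun i => h i i.2.le
  simp only [reducedAboveThresholdBits, ratBit, h1, h k le_rfl]

/-- `restrict_map_haltedTranscript` for bits which are measurable with respect to the σ-algebra
generated by a noise `Φ` independent of the iterates. -/
theorem restrict_map_haltedTranscript_of_comap {Ω S : Type*} [MeasurableSpace Ω]
    [m𝓢 : MeasurableSpace S] {μ : Measure Ω} [IsProbabilityMeasure μ] {A : Ω → ℕ → Y} {Φ : Ω → S}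
    (hA : Measurable A) (hΦ : Measurable Φ) (hind : IndepFun A Φ μ) {B : (ℕ → Y) → Ω → ℕ → Bool}
    (hB : Measurable[MeasurableSpace.pi.prod (m𝓢.comap Φ)]
      fun q : (ℕ → Y) × Ω => B q.1 q.2)
    (hdep : ∀ a a' ω k, (∀ i ≤ k, a i = a' i) → B a ω k = B a' ω k) (m : ℕ) :
    Measurable (fun β : Fin (m + 1) → Y =>
      μ {ω | haltingRound (B (extendIterates m β) ω) = ((m + 1 : ℕ) : ℕ∞)}) ∧
    (μ.map fun ω => haltedTranscript (A ω) (B (A ω) ω)).restrict (transcriptsOfLength Y (m + 1))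
      = ((μ.map fun ω => firstTerms (A ω) (m + 1)).withDensity fun β =>
          μ {ω | haltingRound (B (extendIterates m β) ω) = ((m + 1 : ℕ) : ℕ∞)}).map
            (haltAfter m) := by
  -- The noise variable is taken to be the identity of `Ω`, its target carrying the σ-algebra
  -- generated by `Φ`. The bits then remain functions of `ω`, whose paths are genuine counting
  -- paths.
  have hid : Measurable[_, m𝓢.comap Φ] (id : Ω → Ω) := fun s hs => hΦ.comap_le s hs
  have hind' : @IndepFun _ _ _ _ _ (m𝓢.comap Φ) A (id : Ω → Ω) μ := by
    refine (@IndepFun_iff_Indep _ _ _ _ (_) (m𝓢.comap Φ) _ _ _).2 ?_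
    rw [@MeasurableSpace.comap_id _ (m𝓢.comap Φ)]
    exact (IndepFun_iff_Indep _ _ _).1 hind
  have key := @restrict_map_haltedTranscript _ _ _ _ _ (m𝓢.comap Φ) _ _ _ _ hA hid hind' _ hB
    hdep m
  have hset : ∀ β : Fin (m + 1) → Y,
      (@Measure.map _ _ _ (m𝓢.comap Φ) id μ)
          {ω | haltingRound (B (extendIterates m β) ω) = ((m + 1 : ℕ) : ℕ∞)}
        = μ {ω | haltingRound (B (extendIterates m β) ω) = ((m + 1 : ℕ) : ℕ∞)} := fun β => by
    have hs : MeasurableSet[m𝓢.comap Φ]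
        {ω | haltingRound (B (extendIterates m β) ω) = ((m + 1 : ℕ) : ℕ∞)} :=
      (measurable_haltingRound.comp (hB.comp (@measurable_prodMk_left _ _ _ (m𝓢.comap Φ) _)))
        (measurableSet_singleton _)
    rw [@Measure.map_apply _ _ _ (m𝓢.comap Φ) _ _ hid _ hs]
    rfl
  simp only [hset] at key
  exact key

/-- Once the iterates are fixed, times and scales are deterministic and the halting event is a
`haltingEvent`. Shifting `Z` and shifting the query noise each cost half of the level `E m`. -/
theorem measure_haltingRound_le {Ω : Type*} [MeasurableSpace Ω] {μ : Measure Ω}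
    [IsProbabilityMeasure μ] (hΔ : 0 < Δ) (hεmax : 0 < εmax) (hE : IsPrivacyFunctions εmax E)
    {N : ℝ → Ω → ℕ} {l ξ : ℕ → Ω → ℝ} (h : IsThresholdNoise (2 * Δ / εmax) N l ξ μ)
    {v v' : Y → ℝ} (hv : ∀ β, |v β - v' β| ≤ Δ) (a : ℕ → Y) (m : ℕ) :
    μ {ω | haltingRound (reducedAboveThresholdBits Δ εmax τ v E a
        (fun s => N s ω) (fun n => l n ω) (fun n => ξ n ω)) = ((m + 1 : ℕ) : ℕ∞)}
      ≤ ENNReal.ofReal (Real.exp (E m (firstTerms a m))) *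
        μ {ω | haltingRound (reducedAboveThresholdBits Δ εmax τ v' E a
          (fun s => N s ω) (fun n => l n ω) (fun n => ξ n ω)) = ((m + 1 : ℕ) : ℕ∞)} := by
  have hpos := hE.pos m (firstTerms a m)
  have hev : ∀ v : Y → ℝ, {ω | haltingRound (reducedAboveThresholdBits Δ εmax τ v E a
        (fun s => N s ω) (fun n => l n ω) (fun n => ξ n ω)) = ((m + 1 : ℕ) : ℕ∞)}
      = haltingEvent (2 * Δ / εmax) τ N l ξ (fun k => 2 * Δ / E k (firstTerms a k))
        (fun k => 4 * Δ / E k (firstTerms a k)) (fun k => v (a k)) m := by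
    intro v
    ext ω
    simp only [mem_ofPred_eq, haltingRound_eq_succ_iff, haltingEvent, reducedAboveThresholdBits,
      ratBit, decide_eq_true_eq, decide_eq_false_iff_not]
  rw [hev, hev]
  have hexp : Δ / (2 * Δ / E m (firstTerms a m)) + 2 * Δ / (4 * Δ / E m (firstTerms a m))
      = E m (firstTerms a m) := by
    field_simp
    norm_num
  have := h.measure_haltingEvent_le (τ := τ) (Δ := Δ)
    (T := fun k => 2 * Δ / E k (firstTerms a k)) (b := fun k => 4 * Δ / E k (firstTerms a k))
    (c := fun k => v (a k)) (c' := fun k => v' (a k)) (m := m) (by positivity)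
    (hE.div_le_div hΔ _) (fun k hk => div_le_div_of_nonneg_left (by positivity)
      (hE.pos k _) (hE.monotone_firstTerms a hk.le)) (by positivity) hΔ.le
    (fun k _ => hv (a k))
  rwa [hexp] at this

end Mechanism

end

/-! ### From halting probabilities to the privacy loss -/

theorem theorem5p1 {X Y Ω : Type*} [MeasurableSpace Y] [MeasurableSpace Ω]
    (μ : Measure Ω) [IsProbabilityMeasure μ]
    (Neighbor : X → X → Prop)
    (Alg : X → Ω → ℕ → Y) (hAlg : ∀ x, Measurable (Alg x))
    (Δ εmax τ : ℝ) (hΔ : 0 < Δ) (hεmax : 0 < εmax)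
    (u : Y → X → ℝ) (hu_meas : ∀ x, Measurable fun β => u β x)
    (hu_sens : ∀ β x x', Neighbor x x' → |u β x - u β x'| ≤ Δ)
    (E : (k : ℕ) → (Fin k → Y) → ℝ) (hE : IsPrivacyFunctions εmax E)
    (P : ℝ → Ω → ℕ) (l ξ : ℕ → Ω → ℝ)
    (hnoise : IsThresholdNoise (2 * Δ / εmax) P l ξ μ)
    (hindep : ∀ x, IndepFun (Alg x)
      (fun ω => ((fun t : Set.Ici (2 * Δ / εmax) => P t ω), (fun n => l n ω), fun n => ξ n ω)) μ)
    (x x' : X) (hxx' : Neighbor x x') :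
    let bits : X → Ω → ℕ → Bool := fun y ω =>
      reducedAboveThresholdBits Δ εmax τ (fun β => u β y) E
        (Alg y ω) (fun t => P t ω) (fun n => l n ω) (fun n => ξ n ω)
    let RAT : X → Ω → Transcript Y := fun y ω =>
      reducedAboveThreshold Δ εmax τ (fun β => u β y) E
        (Alg y ω) (fun t => P t ω) (fun n => l n ω) (fun n => ξ n ω)
    let N : X → Ω → ℕ∞ := fun y ω => haltingRound (bits y ω)
    (∀ y, AEMeasurable (RAT y) μ) ∧
    ∀ᵐ ω ∂μ, ∀ n : ℕ, N x ω = n →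
      privacyLoss (μ.map (RAT x)) (μ.map (RAT x')) (RAT x ω) ≤
        privacyLoss (μ.map fun ω' => firstTerms (Alg x ω') n)
            (μ.map fun ω' => firstTerms (Alg x' ω') n) (firstTerms (Alg x ω) n)
          + (E (n - 1) (firstTerms (Alg x ω) (n - 1)) : EReal) := by
  intro bits RAT N
  have hcp := hnoise.poisson.isCountingPath
  let B : X → (ℕ → Y) → Ω → ℕ → Bool := fun y a ω =>
    reducedAboveThresholdBits Δ εmax τ (fun β => u β y) E
      a (fun t => P t ω) (fun n => l n ω) (fun n => ξ n ω)
  have hdep : ∀ y a a' ω k, (∀ i ≤ k, a i = a' i) → B y a ω k = B y a' ω k :=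
    fun y a a' ω k h => reducedAboveThresholdBits_congr _ _ _ h
  have hRAT : ∀ y, Measurable (RAT y) := fun y =>
    measurable_haltedTranscript.comp ((hAlg y).prodMk
      ((measurable_reducedAboveThresholdBits hΔ hεmax hE (hu_meas y) hcp hnoise.poisson.measurable
        hnoise.marks.measurable hnoise.query.measurable).comp ((hAlg y).prodMk measurable_id)))
  refine ⟨fun y => (hRAT y).aemeasurable, ?_⟩
  let Φ : Ω → (Ici (2 * Δ / εmax) → ℕ) × (ℕ → ℝ) × (ℕ → ℝ) := fun ω =>
    ((fun t => P t ω), (fun n => l n ω), fun n => ξ n ω)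
  have hΦ : Measurable Φ :=
    (measurable_pi_lambda _ fun t => hnoise.poisson.measurable _ t.2).prodMk
      ((measurable_pi_lambda _ fun n => hnoise.marks.measurable n).prodMk
        (measurable_pi_lambda _ fun n => hnoise.query.measurable n))
  have hP' : ∀ s, 2 * Δ / εmax ≤ s → Measurable[Prod.instMeasurableSpace.comap Φ] (P s) :=
    fun s hs => ((measurable_pi_apply (⟨s, hs⟩ : Ici (2 * Δ / εmax))).comp measurable_fst).comp
      (comap_measurable Φ)
  have hl' : ∀ n, Measurable[Prod.instMeasurableSpace.comap Φ] (l n) := fun n =>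
    ((measurable_pi_apply n).comp (measurable_fst.comp measurable_snd)).comp (comap_measurable Φ)
  have hξ' : ∀ n, Measurable[Prod.instMeasurableSpace.comap Φ] (ξ n) := fun n =>
    ((measurable_pi_apply n).comp (measurable_snd.comp measurable_snd)).comp (comap_measurable Φ)
  have hlaw := fun y m => restrict_map_haltedTranscript_of_comap (hAlg y) hΦ (hindep y)
    (B := B y) (@measurable_reducedAboveThresholdBits _ _ _ _ _ _ _
      (Prod.instMeasurableSpace.comap Φ) hΔ hεmax hE _ (hu_meas y) _ hcp hP' _ _ hl' hξ') (hdep y) m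
  have hprob : ∀ y, IsProbabilityMeasure (μ.map (RAT y)) := fun y =>
    Measure.isProbabilityMeasure_map (hRAT y).aemeasurable
  have hprob' : ∀ y n, IsProbabilityMeasure (μ.map fun ω => firstTerms (Alg y ω) n) := fun y n =>
    Measure.isProbabilityMeasure_map ((measurable_firstTerms n).comp (hAlg y)).aemeasurable
  obtain ⟨ω₀⟩ : Nonempty Ω := μ.nonempty_of_neZero
  -- An arbitrary iterate, used only to fill transcripts that are too short.
  let y₀ := Alg x ω₀ 0
  have hle : ∀ (m : ℕ) (β : Fin (m + 1) → Y),
      μ {ω | haltingRound (B x (extendIterates m β) ω) = ((m + 1 : ℕ) : ℕ∞)}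
        ≤ ENNReal.ofReal (Real.exp (E m fun i => β i.castSucc)) *
          μ {ω | haltingRound (B x' (extendIterates m β) ω) = ((m + 1 : ℕ) : ℕ∞)} := by
    intro m β
    have hβ : firstTerms (extendIterates m β) m = fun i => β i.castSucc := by
      funext i
      exact congrArg β (Fin.ext (min_eq_left i.2.le))
    have := measure_haltingRound_le (τ := τ) hΔ hεmax hE hnoise
      (fun β => hu_sens β x x' hxx') (extendIterates m β) m
    rwa [hβ] at this
  -- The iterates are read off the transcript, so the bound concerns the transcript alone and
  -- transfers from its law to `μ`, for all `m` at once.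
  have hloss : ∀ᵐ ω ∂μ, ∀ m : ℕ, RAT x ω ∈ transcriptsOfLength Y (m + 1) →
      privacyLoss (μ.map (RAT x)) (μ.map (RAT x')) (RAT x ω) ≤
        privacyLoss (μ.map fun ω' => firstTerms (Alg x ω') (m + 1))
            (μ.map fun ω' => firstTerms (Alg x' ω') (m + 1))
            (transcriptIterates y₀ (m + 1) (RAT x ω))
          + (E m (fun i => transcriptIterates y₀ (m + 1) (RAT x ω) i.castSucc) : EReal) := by
    refine ae_all_iff.2 fun m => ?_
    have h := privacyLoss_le_privacyLoss_add (ε := fun β => E m fun i => β i.castSucc)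
      (measurableSet_transcriptsOfLength (m + 1)) (measurable_haltAfter m)
      (measurable_transcriptIterates y₀ (m + 1)) (transcriptIterates_haltAfter y₀ m)
      (hlaw x m).1 (hlaw x' m).1 (hlaw x m).2 (hlaw x' m).2
      ((hE.measurable m).comp (measurable_pi_lambda _ fun i => measurable_pi_apply _)) (hle m)
    exact ae_of_ae_map (hRAT x).aemeasurable h
  filter_upwards [hloss] with ω hω n hn
  -- Rounds are counted from `1`: `n = 0` never occurs, and for `n = m + 1` the level is `E m`.
  cases n with
  | zero => exact absurd hn (haltingRound_ne_zero _)
  | succ m =>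
    have h := hω m (haltedTranscript_mem_transcriptsOfLength.2 hn)
    have hit : transcriptIterates y₀ (m + 1) (RAT x ω) = firstTerms (Alg x ω) (m + 1) :=
      (congrArg _ (haltedTranscript_eq_haltAfter hn)).trans (transcriptIterates_haltAfter _ _ _)
    rw [hit] at h
    exact h
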